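/- Let $n\ge 1$, $0<s<1$, let $u_0\in L^1(\mathbb{R}^n)$ be real-valued (of any sign) and let $M=\int_{\mathbb{R}^n}u_0(x)\,dx$ be its mass. Let $(-\Delta)^s$ be the fractional Laplacian, i.e. the Fourier multiplier with symbol $|\xi|^{2s}$, and let $P_t$ be the fundamental solution of the fractional heat equation $\partial_t u+(-\Delta)^s u=0$, i.e. $P_t(x)=(2\pi)^{-n}\int_{\mathbb{R}^n}e^{ix\cdot\xi}e^{-t|\xi|^{2s}}\,d\xi$ for $t>0$. Let $u$ be the weak solution of the fractional heat equation in $\mathbb{R}^n$ with initial datum $u_0$, i.e. $u\in C([0,\infty);L^1(\mathbb{R}^n))$, $u(0)=u_0$, and $$\int_0^\infty\!\!\int_{\mathbb{R}^n}u(x,t)\,\bigl(\partial_t\psi(x,t)-(-\Delta)^s\psi(x,t)\bigr)\,dx\,dt=0$$ for all $\psi\in C_c^\infty(\mathbb{R}^n\times(0,\infty))$, where $(-\Delta)^s$ acts in $x$. Then $$\lim_{t\to\infty}\|u(t)-MP_t\|_{L^1(\mathbb{R}^n)}=0,\qquad \lim_{t\to\infty}t^{\frac{n}{2s}}\|u(t)-MP_t\|_{L^\infty(\mathbb{R}^n)}=0,$$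 and, for every $1\le p\le\infty$, $$\lim_{t\to\infty}t^{\frac{n(p-1)}{2sp}}\|u(t)-MP_t\|_{L^p(\mathbb{R}^n)}=0,$$ where the exponent $\frac{n(p-1)}{2sp}$ is read as $\frac{n}{2s}$ for $p=\infty$. -/

import Mathlib

open MeasureTheory Filter Topology Set
open scoped FourierTransform ContDiff

noncomputable section

namespace FracHeat

/-- The fractional Laplacian `(-Δ)^s` of a test function on `ℝⁿ`, as the Fourier multiplier with
symbol `|ξ|^{2s}`. Mathlib's Fourier transform has the kernel `exp (-2πi ⟨x, ξ⟩)`, so that the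
symbol reads `(2π|ξ|)^{2s}` in its frequency variable. The result is real for real-valued `φ`. -/
def fracLaplacian {n : ℕ} (s : ℝ) (φ : EuclideanSpace ℝ (Fin n) → ℝ)
    (x : EuclideanSpace ℝ (Fin n)) : ℝ :=
  (𝓕⁻ (fun ξ : EuclideanSpace ℝ (Fin n) =>
    (((2 * Real.pi * ‖ξ‖) ^ (2 * s) : ℝ) : ℂ) * 𝓕 (fun y => (φ y : ℂ)) ξ) x).re

/-- The fundamental solution `P(x,t;s)` (the fractional heat kernel): the inverse Fourier transform
in `x` of `exp (-t|ξ|^{2s})`, with the same normalization of the frequency variable as above. -/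
def heatKernel {n : ℕ} (s t : ℝ) (x : EuclideanSpace ℝ (Fin n)) : ℝ :=
  (𝓕⁻ (fun ξ : EuclideanSpace ℝ (Fin n) =>
    ((Real.exp (-(t * (2 * Real.pi * ‖ξ‖) ^ (2 * s))) : ℝ) : ℂ)) x).re

/-- `u` is a weak (distributional) solution of `∂ₜu + (-Δ)^s u = 0` in `ℝⁿ × (0,∞)` with initial
datum `u₀`: it is continuous from `[0,∞)` to `L¹(ℝⁿ)`, equals `u₀` at time `0`, and satisfies the
equation tested against all smooth functions with compact support in `(0,∞) × ℝⁿ`. -/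
structure IsWeakSolution {n : ℕ} (s : ℝ) (u₀ : EuclideanSpace ℝ (Fin n) → ℝ)
    (u : ℝ → Lp ℝ 1 (volume : Measure (EuclideanSpace ℝ (Fin n)))) : Prop where
  continuousOn : ContinuousOn u (Ici 0)
  initial : (u 0 : EuclideanSpace ℝ (Fin n) → ℝ) =ᵐ[volume] u₀
  weak_eq : ∀ ψ : ℝ × EuclideanSpace ℝ (Fin n) → ℝ, ContDiff ℝ ∞ ψ → HasCompactSupport ψ →
    tsupport ψ ⊆ Ioi 0 ×ˢ univ →
    ∫ t in Ioi (0 : ℝ), ∫ x, (u t : EuclideanSpace ℝ (Fin n) → ℝ) x *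
      (deriv (fun τ => ψ (τ, x)) t - fracLaplacian s (fun y => ψ (t, y)) x) = 0

end FracHeat

end

/-! On the Fourier side the equation is an ODE for each frequency, so a weak solution must have
transform `û(t,ξ) = exp(-t|ξ|^{2s}) û₀(ξ)`; everything else is read off this formula.

The formula needs test functions that single out one frequency `ζ`. A plane wave is not compactly
supported, so the weak equation is tested with `θ(t)` times a wave packet, a plane wave cut off at
scale `1/r`. As `r → 0` its fractional Laplacian stays bounded and tends pointwise to `|ζ|^{2s}`
times the wave (`tendsto_fracLaplacian_wavePacket`). The cosine transforms of `u` then solve `w' =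
-|ζ|^{2s} w` weakly, and continuity into `L¹` fixes the initial value (`IsWeakSolution.fourier_eq`).
Fourier inversion gives `u(t) = P_t * u₀`.

The kernel is nonnegative because `exp(-c|ξ|^{2s})` is a limit of mixtures of Gaussians
(`isPosRadial_exp_neg_rpow`): `r^s` is a constant times `∫ (1 - e^{-lr}) l^{-1-s} dl`, and cutting
this integral off near `l = 0` leaves the exponential of a Laplace transform. Nonnegativity and a
bound on Gaussian-damped masses give `P_t ∈ L¹`.

For `L¹`, `u(t) - M P_t` is the average of `P_t(x - y) - P_t(x)` against `u₀(y) dy`. By scaling, its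
norm is at most the average of the `L¹` distance between `P_1` and its translate by `t^{-1/(2s)} y`,
which tends to zero. For `L^∞`, the transform of the difference is `exp(-t|ξ|^{2s}) (û₀(ξ) -
û₀(0))`, whose `L¹` norm, after scaling out `t^{-n/(2s)}`, vanishes by continuity of `û₀` at `0`.
The other `p` follow by interpolation. -/

section FourierTools

/-! ### Multiplication formula and inversion for the `L¹` Fourier transform. -/

theorem MeasureTheory.Integrable.complex_ofReal {α : Type*} [MeasurableSpace α] {μ : Measure α}
    {f : α → ℝ} (hf : Integrable f μ) : Integrable (fun x => (f x : ℂ)) μ :=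
  hf.ofReal

variable {V : Type*} [NormedAddCommGroup V] [InnerProductSpace ℝ V] [FiniteDimensional ℝ V]
  [MeasurableSpace V] [BorelSpace V]

theorem integral_fourier_mul_eq {f g : V → ℂ} (hf : Integrable f) (hg : Integrable g) :
    ∫ ξ, 𝓕 f ξ * g ξ = ∫ x, f x * 𝓕 g x := by
  have := VectorFourier.integral_fourierIntegral_smul_eq_flip (L := innerₗ V) (μ := volume)
    (ν := volume) Real.continuous_fourierChar continuous_inner hf hg
  simp only [flip_innerₗ, smul_eq_mul] at this
  exact this

theorem integral_fourierInv_mul_eq {f g : V → ℂ} (hf : Integrable f) (hg : Integrable g) :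
    ∫ ξ, 𝓕⁻ f ξ * g ξ = ∫ x, f x * 𝓕⁻ g x := by
  have h := integral_fourier_mul_eq hf hg.comp_neg
  simp only [Real.fourierInv_eq_fourier_neg]
  rw [← integral_neg_eq_self]
  simp only [neg_neg]
  rw [h]
  congr 1; ext x
  rw [← Real.fourierInv_eq_fourier_neg, Real.fourierInv_eq_fourier_comp_neg g]

theorem continuous_fourier {f : V → ℂ} (hf : Integrable f) : Continuous (𝓕 f) :=
  VectorFourier.fourierIntegral_continuous Real.continuous_fourierChar continuous_inner hf

theorem continuous_fourierInv {f : V → ℂ} (hf : Integrable f) : Continuous (𝓕⁻ f) := by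
  rw [Real.fourierInv_eq_fourier_comp_neg]
  exact continuous_fourier hf.comp_neg

theorem norm_fourier_le (f : V → ℂ) (ξ : V) : ‖𝓕 f ξ‖ ≤ ∫ x, ‖f x‖ :=
  VectorFourier.norm_fourierIntegral_le_integral_norm _ _ _ _ _

theorem norm_fourierInv_le (f : V → ℂ) (x : V) : ‖𝓕⁻ f x‖ ≤ ∫ ξ, ‖f ξ‖ := by
  rw [Real.fourierInv_eq_fourier_neg]
  exact norm_fourier_le f _

/-- Continuity of `f` is not assumed, so inversion is proved by duality: against a smooth compactly
supported test function, two applications of the multiplication formula move both transforms onto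
the test function, where Schwartz inversion applies. -/
theorem fourierInv_fourier_ae_eq {f : V → ℂ} (hf : Integrable f) (hf' : Integrable (𝓕 f)) :
    𝓕⁻ (𝓕 f) =ᵐ[volume] f := by
  have hc := continuous_fourierInv hf'
  have hloc : LocallyIntegrable (𝓕⁻ (𝓕 f) - f) volume :=
    hc.locallyIntegrable.sub hf.locallyIntegrable
  have := ae_eq_zero_of_integral_contDiff_smul_eq_zero (μ := volume) hloc (fun g hg hgc => by
    let gS : SchwartzMap V ℂ :=
      (HasCompactSupport.toSchwartzMap (f := fun x => (g x : ℂ))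
        (hgc.comp_left Complex.ofReal_zero) (Complex.ofRealCLM.contDiff.comp hg))
    have hgS : ∀ x, gS x = (g x : ℂ) := fun x => rfl
    have h1 : ∫ x, 𝓕⁻ (𝓕 f) x * gS x = ∫ x, f x * gS x := by
      rw [integral_fourierInv_mul_eq hf' gS.integrable]
      have : 𝓕⁻ (gS : V → ℂ) = (𝓕⁻ gS : SchwartzMap V ℂ) := (SchwartzMap.fourierInv_coe gS).symm
      rw [this, integral_fourier_mul_eq hf (SchwartzMap.integrable _)]
      have h2 : 𝓕 ((𝓕⁻ gS : SchwartzMap V ℂ) : V → ℂ) = gS := by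
        rw [← SchwartzMap.fourier_coe]; simp
      rw [h2]
    have hi1 : Integrable (fun x => 𝓕⁻ (𝓕 f) x * gS x) := by
      refine gS.integrable.bdd_mul hc.aestronglyMeasurable
        (Eventually.of_forall fun x => norm_fourierInv_le _ x)
    have hi2 : Integrable (fun x => f x * gS x) := by
      have hgi : Continuous gS := gS.continuous
      obtain ⟨C, hC⟩ := hgi.bounded_above_of_compact_support
        (hgc.comp_left (g := fun r : ℝ => (r : ℂ)) Complex.ofReal_zero)
      exact hf.mul_bdd hgi.aestronglyMeasurable (Eventually.of_forall hC)
    rw [← sub_eq_zero, ← integral_sub hi1 hi2] at h1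
    rw [← h1]
    congr 1; ext x
    simp only [Pi.sub_apply, Complex.real_smul, hgS]
    ring)
  filter_upwards [this] with x hx
  exact sub_eq_zero.1 hx

end FourierTools

/-! ### Radial functions with nonnegative Fourier transform. -/

section GaussianMixtures

theorem norm_mul_exp_mul_cos_le {a C : ℝ} (ha : |a| ≤ C) (b c : ℝ) :
    ‖a * (Real.exp b * Real.cos c)‖ ≤ C * Real.exp b := by
  rw [norm_mul, norm_mul, Real.norm_eq_abs, Real.norm_eq_abs, Real.norm_eq_abs, Real.abs_exp]
  have := Real.abs_cos_le_one c
  have h0 := (abs_nonneg a).trans ha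
  gcongr
  exact mul_le_of_le_one_right (Real.exp_pos _).le this

open scoped RealInnerProductSpace

variable {V : Type*} [NormedAddCommGroup V] [InnerProductSpace ℝ V] [FiniteDimensional ℝ V]
  [MeasurableSpace V] [BorelSpace V]

theorem integrable_exp_neg_mul_sq_norm {δ : ℝ} (hδ : 0 < δ) :
    Integrable (fun ξ : V => Real.exp (-δ * ‖ξ‖ ^ 2)) := by
  have h := GaussianFourier.integrable_cexp_neg_mul_sq_norm_add (V := V)
    (show 0 < (δ : ℂ).re from hδ) 0 0
  refine h.norm.congr (Eventually.of_forall fun ξ => ?_)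
  simp only [Complex.norm_exp]
  simp [← Complex.ofReal_pow]

theorem fourierInv_ofReal_of_even {f : V → ℝ} (hf : Integrable f) (he : ∀ ξ, f (-ξ) = f ξ)
    (x : V) :
    𝓕⁻ (fun ξ => (f ξ : ℂ)) x = ((∫ ξ, f ξ * Real.cos (2 * Real.pi * ⟪ξ, x⟫) : ℝ) : ℂ) := by
  have hs : ∫ ξ, f ξ * Real.sin (2 * Real.pi * ⟪ξ, x⟫) = 0 := by
    have h := integral_neg_eq_self (fun ξ => f ξ * Real.sin (2 * Real.pi * ⟪ξ, x⟫)) volume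
    simp only [he, inner_neg_left, mul_neg, Real.sin_neg, integral_neg] at h
    linarith
  have hc1 : Integrable (fun ξ => f ξ * Real.cos (2 * Real.pi * ⟪ξ, x⟫)) :=
    hf.mul_bdd (c := 1) (by fun_prop) (Eventually.of_forall fun ξ => Real.abs_cos_le_one _)
  have hs1 : Integrable (fun ξ => f ξ * Real.sin (2 * Real.pi * ⟪ξ, x⟫)) :=
    hf.mul_bdd (c := 1) (by fun_prop) (Eventually.of_forall fun ξ => Real.abs_sin_le_one _)
  have : ∀ ξ, Complex.exp (↑(2 * Real.pi * ⟪ξ, x⟫) * Complex.I) • (f ξ : ℂ) =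
      ((f ξ * Real.cos (2 * Real.pi * ⟪ξ, x⟫) : ℝ) : ℂ) +
        ((f ξ * Real.sin (2 * Real.pi * ⟪ξ, x⟫) : ℝ) : ℂ) * Complex.I := by
    intro ξ
    rw [Complex.exp_mul_I]
    push_cast
    simp only [smul_eq_mul]
    ring
  rw [Real.fourierInv_eq']
  simp_rw [this]
  rw [integral_add hc1.ofReal (hs1.ofReal.mul_const _), integral_mul_const,
    integral_complex_ofReal, integral_complex_ofReal, hs]
  simp

/-- The cosine transform of a Gaussian is again a Gaussian, with positive coefficient. -/
theorem integral_gaussian_mul_cos_nonneg {δ : ℝ} (hδ : 0 < δ) (x : V) :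
    0 ≤ ∫ ξ : V, Real.exp (-δ * ‖ξ‖ ^ 2) * Real.cos (2 * Real.pi * ⟪ξ, x⟫) := by
  have h := fourierInv_ofReal_of_even (integrable_exp_neg_mul_sq_norm (V := V) hδ) (by simp) x
  have h2 := _root_.fourier_gaussian_innerProductSpace (V := V)
    (show 0 < (δ : ℂ).re from hδ) (-x)
  rw [← Real.fourierInv_eq_fourier_neg] at h2
  have h3 : ((∫ ξ : V, Real.exp (-δ * ‖ξ‖ ^ 2) * Real.cos (2 * Real.pi * ⟪ξ, x⟫) : ℝ) : ℂ) =
      (((Real.pi / δ) ^ ((Module.finrank ℝ V : ℝ) / 2) *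
        Real.exp (-Real.pi ^ 2 * ‖-x‖ ^ 2 / δ) : ℝ) : ℂ) := by
    rw [← h]
    push_cast
    rw [h2, Complex.ofReal_cpow (by positivity)]
    push_cast
    rfl
  rw [Complex.ofReal_inj.1 h3]
  positivity

variable (V) in
/-- `ξ ↦ h (‖ξ‖ ^ 2)` is bounded and, damped by any Gaussian, has a nonnegative Fourier
transform. -/
structure IsPosRadial (h : ℝ → ℝ) : Prop where
  measurable : Measurable h
  bdd : ∃ C, ∀ r, 0 ≤ r → |h r| ≤ C
  nonneg : ∀ δ : ℝ, 0 < δ → ∀ x : V,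
    0 ≤ ∫ ξ : V, h (‖ξ‖ ^ 2) * (Real.exp (-δ * ‖ξ‖ ^ 2) * Real.cos (2 * Real.pi * ⟪ξ, x⟫))

theorem integrable_gaussian_mul_cos {δ : ℝ} (hδ : 0 < δ) (x : V) :
    Integrable (fun ξ : V => Real.exp (-δ * ‖ξ‖ ^ 2) * Real.cos (2 * Real.pi * ⟪ξ, x⟫)) :=
  (integrable_exp_neg_mul_sq_norm hδ).mul_bdd (c := 1) (by fun_prop)
    (Eventually.of_forall fun ξ => Real.abs_cos_le_one _)

namespace IsPosRadial

theorem integrable {h : ℝ → ℝ} (hh : IsPosRadial V h) {δ : ℝ} (hδ : 0 < δ) (x : V) :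
    Integrable (fun ξ : V => h (‖ξ‖ ^ 2) *
      (Real.exp (-δ * ‖ξ‖ ^ 2) * Real.cos (2 * Real.pi * ⟪ξ, x⟫))) := by
  obtain ⟨C, hC⟩ := hh.bdd
  refine (integrable_gaussian_mul_cos hδ x).bdd_mul (c := C) ?_
    (Eventually.of_forall fun ξ => hC _ (by positivity))
  exact (hh.measurable.comp (by fun_prop)).aestronglyMeasurable

theorem one : IsPosRadial V (fun _ => 1) where
  measurable := measurable_const
  bdd := ⟨1, by simp⟩
  nonneg δ hδ x := by simpa using integral_gaussian_mul_cos_nonneg hδ x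

theorem add {h k : ℝ → ℝ} (hh : IsPosRadial V h) (hk : IsPosRadial V k) :
    IsPosRadial V (fun r => h r + k r) where
  measurable := hh.measurable.add hk.measurable
  bdd := by
    obtain ⟨C, hC⟩ := hh.bdd
    obtain ⟨D, hD⟩ := hk.bdd
    exact ⟨C + D, fun r hr => (abs_add_le _ _).trans (add_le_add (hC r hr) (hD r hr))⟩
  nonneg δ hδ x := by
    simp only [add_mul]
    rw [integral_add (hh.integrable hδ x) (hk.integrable hδ x)]
    exact add_nonneg (hh.nonneg δ hδ x) (hk.nonneg δ hδ x)

theorem const_mul {h : ℝ → ℝ} (hh : IsPosRadial V h) {c : ℝ} (hc : 0 ≤ c) :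
    IsPosRadial V (fun r => c * h r) where
  measurable := hh.measurable.const_mul c
  bdd := by
    obtain ⟨C, hC⟩ := hh.bdd
    exact ⟨c * C, fun r hr => by
      rw [abs_mul, abs_of_nonneg hc]; exact mul_le_mul_of_nonneg_left (hC r hr) hc⟩
  nonneg δ hδ x := by
    simp only [mul_assoc]
    rw [integral_const_mul]
    exact mul_nonneg hc (by simpa only [mul_assoc] using hh.nonneg δ hδ x)

/-- The Gaussian damping in `IsPosRadial` makes a uniform bound enough for dominated convergence,
although the functions themselves need not be integrable. -/
theorem of_tendsto {h : ℕ → ℝ → ℝ} {g : ℝ → ℝ} (hh : ∀ k, IsPosRadial V (h k))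
    (hg : Measurable g) {C : ℝ} (hC : ∀ k r, 0 ≤ r → |h k r| ≤ C)
    (hlim : ∀ r, 0 ≤ r → Tendsto (fun k => h k r) atTop (𝓝 (g r))) : IsPosRadial V g where
  measurable := hg
  bdd := ⟨C, fun r hr => le_of_tendsto (hlim r hr).abs (Eventually.of_forall fun k => hC k r hr)⟩
  nonneg δ hδ x := by
    refine ge_of_tendsto (x := atTop) (f := fun k => ∫ ξ : V, h k (‖ξ‖ ^ 2) *
      (Real.exp (-δ * ‖ξ‖ ^ 2) * Real.cos (2 * Real.pi * ⟪ξ, x⟫))) ?_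
      (Eventually.of_forall fun k => (hh k).nonneg δ hδ x)
    refine tendsto_integral_of_dominated_convergence (fun ξ => C * Real.exp (-δ * ‖ξ‖ ^ 2))
      (fun k => ((hh k).integrable hδ x).aestronglyMeasurable)
      ((integrable_exp_neg_mul_sq_norm hδ).const_mul C)
      (fun k => Eventually.of_forall fun ξ => ?_) (Eventually.of_forall fun ξ => ?_)
    · exact norm_mul_exp_mul_cos_le (hC k _ (by positivity)) _ _
    · exact (hlim _ (by positivity)).mul_const _

/-- Multiplication by a Laplace transform of a nonnegative integrable density. -/
theorem laplace_mul {h κ : ℝ → ℝ} (hh : IsPosRadial V h) {ε : ℝ} (hε : 0 < ε)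
    (hκm : Measurable κ) (hκ : IntegrableOn κ (Ioi ε)) (hκ0 : ∀ l ∈ Ioi ε, 0 ≤ κ l) :
    IsPosRadial V (fun r => (∫ l in Ioi ε, Real.exp (-(l * r)) * κ l) * h r) where
  measurable := by
    refine Measurable.mul ?_ hh.measurable
    refine (StronglyMeasurable.integral_prod_right (f := fun r l => Real.exp (-(l * r)) * κ l)
      ?_).measurable
    exact Measurable.stronglyMeasurable (by fun_prop)
  bdd := by
    obtain ⟨C, hC⟩ := hh.bdd
    refine ⟨(∫ l in Ioi ε, κ l) * C, fun r hr => ?_⟩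
    rw [abs_mul]
    refine mul_le_mul ?_ (hC r hr) (abs_nonneg _)
      (setIntegral_nonneg measurableSet_Ioi hκ0)
    rw [← Real.norm_eq_abs]
    refine norm_integral_le_of_norm_le hκ ?_
    filter_upwards [ae_restrict_mem measurableSet_Ioi] with l hl
    rw [norm_mul, Real.norm_eq_abs, Real.norm_eq_abs, Real.abs_exp, abs_of_nonneg (hκ0 l hl)]
    refine mul_le_of_le_one_left (hκ0 l hl) (Real.exp_le_one_iff.2 ?_)
    have : 0 ≤ l * r := mul_nonneg (hε.le.trans (le_of_lt hl)) hr
    linarith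
  nonneg δ hδ x := by
    obtain ⟨C, hC⟩ := hh.bdd
    -- By Fubini the factor `exp(-l‖ξ‖²)` only strengthens the damping from `δ` to `δ + l`, and the
    -- hypothesis on `h` covers every positive damping.
    have key : ∫ ξ : V, (∫ l in Ioi ε, Real.exp (-(l * ‖ξ‖ ^ 2)) * κ l) * h (‖ξ‖ ^ 2) *
        (Real.exp (-δ * ‖ξ‖ ^ 2) * Real.cos (2 * Real.pi * ⟪ξ, x⟫)) =
        ∫ l in Ioi ε, κ l * ∫ ξ : V, h (‖ξ‖ ^ 2) *
          (Real.exp (-(δ + l) * ‖ξ‖ ^ 2) * Real.cos (2 * Real.pi * ⟪ξ, x⟫)) := by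
      simp_rw [← integral_const_mul, mul_assoc (∫ l in Ioi ε, _ : ℝ), ← integral_mul_const]
      rw [integral_integral_swap]
      · congr 1; ext l; congr 1; ext ξ
        rw [show -(δ + l) * ‖ξ‖ ^ 2 = -(l * ‖ξ‖ ^ 2) + -δ * ‖ξ‖ ^ 2 by ring, Real.exp_add]
        ring
      · have hb : Integrable (fun z : V × ℝ => (h (‖z.1‖ ^ 2) *
            (Real.exp (-δ * ‖z.1‖ ^ 2) * Real.cos (2 * Real.pi * ⟪z.1, x⟫))) * κ z.2)
            (volume.prod (volume.restrict (Ioi ε))) := (hh.integrable hδ x).mul_prod hκ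
        refine hb.mono ?_ ?_
        · have := hh.measurable
          refine Measurable.aestronglyMeasurable ?_
          simp only [Function.uncurry_def]
          fun_prop
        · have hmem : ∀ᵐ z : V × ℝ ∂(volume.prod (volume.restrict (Ioi ε))), z.2 ∈ Ioi ε := by
            exact Measure.quasiMeasurePreserving_snd.ae (ae_restrict_mem measurableSet_Ioi)
          filter_upwards [hmem] with z hz
          simp only [Function.uncurry_def, norm_mul, Real.norm_eq_abs, Real.abs_exp]
          have h1 : Real.exp (-(z.2 * ‖z.1‖ ^ 2)) ≤ 1 := by
            refine Real.exp_le_one_iff.2 ?_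
            have : 0 ≤ z.2 * ‖z.1‖ ^ 2 := mul_nonneg (hε.le.trans (le_of_lt hz)) (by positivity)
            linarith
          rw [mul_assoc, mul_comm |κ z.2|]
          exact mul_le_of_le_one_left (by positivity) h1
    rw [key]
    refine setIntegral_nonneg measurableSet_Ioi fun l hl => mul_nonneg (hκ0 l hl) ?_
    exact hh.nonneg _ (add_pos hδ (hε.trans hl)) x

end IsPosRadial

end GaussianMixtures

/-! ### Subordination: `exp(-c r^s)` as a limit of Gaussian mixtures. -/

section StableDensity

open scoped RealInnerProductSpace

variable {V : Type*} [NormedAddCommGroup V] [InnerProductSpace ℝ V] [FiniteDimensional ℝ V]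
  [MeasurableSpace V] [BorelSpace V]

namespace IsPosRadial

/-- Negative definite functions given by a finite Lévy measure exponentiate to positive definite
functions. -/
theorem exp_laplace {κ : ℝ → ℝ} {ε : ℝ} (hε : 0 < ε)
    (hκm : Measurable κ) (hκ : IntegrableOn κ (Ioi ε)) (hκ0 : ∀ l ∈ Ioi ε, 0 ≤ κ l) :
    IsPosRadial V (fun r => Real.exp (∫ l in Ioi ε, Real.exp (-(l * r)) * κ l)) := by
  set g : ℝ → ℝ := fun r => ∫ l in Ioi ε, Real.exp (-(l * r)) * κ l with hg
  -- The class is a cone stable under multiplication by `g`, so it contains the partial sums of the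
  -- exponential series; these are bounded by `exp C`.
  have hpow : ∀ k : ℕ, IsPosRadial V (fun r => g r ^ k) := by
    intro k
    induction k with
    | zero => simpa using one
    | succ k ih => simpa only [pow_succ'] using ih.laplace_mul hε hκm hκ hκ0
  have hg1 : IsPosRadial V g := by simpa using hpow 1
  obtain ⟨C, hC⟩ := hg1.bdd
  have hsum : ∀ N : ℕ, IsPosRadial V
      (fun r => ∑ k ∈ Finset.range N, (k.factorial : ℝ)⁻¹ * g r ^ k) := by
    intro N
    induction N with
    | zero => simpa using (one (V := V)).const_mul (le_refl 0)
    | succ N ih =>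
      simp only [Finset.sum_range_succ]
      exact ih.add ((hpow N).const_mul (by positivity))
  refine of_tendsto hsum (Real.measurable_exp.comp hg1.measurable) (C := Real.exp C) ?_ ?_
  · intro N r hr
    calc |∑ k ∈ Finset.range N, (k.factorial : ℝ)⁻¹ * g r ^ k|
        ≤ ∑ k ∈ Finset.range N, C ^ k / k.factorial := by
          refine (Finset.abs_sum_le_sum_abs _ _).trans (Finset.sum_le_sum fun k _ => ?_)
          rw [abs_mul, abs_pow, abs_of_nonneg (by positivity : (0:ℝ) ≤ (k.factorial : ℝ)⁻¹),
            div_eq_inv_mul]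
          gcongr
          exact hC r hr
      _ ≤ Real.exp C := Real.sum_le_exp_of_nonneg ((abs_nonneg _).trans (hC r hr)) N
  · intro r _
    have := (NormedSpace.expSeries_div_hasSum_exp (𝔸 := ℝ) (g r)).tendsto_sum_nat
    simp only [div_eq_inv_mul] at this
    rwa [← Real.exp_eq_exp_ℝ] at this

end IsPosRadial

/-- Near `0` the bound `1 - e^{-lr} ≤ lr` leaves `l^{-s}`, integrable since `s < 1`; on `(1,∞)` the
bound by `1` leaves `l^{-1-s}`, integrable since `s > 0`. -/
theorem integrableOn_one_sub_exp_mul_rpow {s : ℝ} (hs0 : 0 < s) (hs1 : s < 1) {r : ℝ}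
    (hr : 0 ≤ r) :
    IntegrableOn (fun l : ℝ => (1 - Real.exp (-(l * r))) * l ^ (-1 - s)) (Ioi 0) := by
  rw [← Ioc_union_Ioi_eq_Ioi zero_le_one]
  have hb : ∀ l : ℝ, 0 < l → 0 ≤ 1 - Real.exp (-(l * r)) := fun l hl => by
    have : Real.exp (-(l * r)) ≤ 1 := Real.exp_le_one_iff.2 (by
      have := mul_nonneg hl.le hr; linarith)
    linarith
  refine IntegrableOn.union ?_ ?_
  · have h1 : IntegrableOn (fun l : ℝ => r * l ^ (-s)) (Ioc 0 1) :=
      ((intervalIntegrable_iff_integrableOn_Ioc_of_le zero_le_one).1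
        (intervalIntegral.intervalIntegrable_rpow' (by linarith))).const_mul r
    refine h1.mono' (Measurable.aestronglyMeasurable (by fun_prop)) ?_
    filter_upwards [ae_restrict_mem measurableSet_Ioc] with l hl
    rw [Real.norm_of_nonneg (mul_nonneg (hb l hl.1) (Real.rpow_nonneg hl.1.le _))]
    have h2 : 1 - Real.exp (-(l * r)) ≤ l * r := by
      have := Real.add_one_le_exp (-(l * r)); linarith
    calc _ ≤ l * r * l ^ (-1 - s) := by
          gcongr
          exact Real.rpow_nonneg hl.1.le _
      _ = r * l ^ (-s) := by
        rw [show -s = 1 + (-1 - s) by ring, Real.rpow_add hl.1, Real.rpow_one]; ring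
  · have h1 : IntegrableOn (fun l : ℝ => l ^ (-1 - s)) (Ioi 1) :=
      integrableOn_Ioi_rpow_of_lt (by linarith) zero_lt_one
    refine h1.mono' (Measurable.aestronglyMeasurable (by fun_prop)) ?_
    filter_upwards [ae_restrict_mem measurableSet_Ioi] with l hl
    have hl0 : (0:ℝ) < l := zero_lt_one.trans hl
    rw [Real.norm_of_nonneg (mul_nonneg (hb l hl0) (Real.rpow_nonneg hl0.le _))]
    refine mul_le_of_le_one_left (Real.rpow_nonneg hl0.le _) ?_
    have := Real.exp_pos (-(l * r)); linarith

/-- The substitution `l ↦ r l` extracts `r^s`. This is the Lévy–Khintchine representation of the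
Bernstein function `r^s`. -/
theorem integral_one_sub_exp_mul_rpow {s : ℝ} (hs0 : 0 < s) {r : ℝ} (hr : 0 ≤ r) :
    ∫ l in Ioi (0 : ℝ), (1 - Real.exp (-(l * r))) * l ^ (-1 - s) =
      (∫ l in Ioi (0 : ℝ), (1 - Real.exp (-l)) * l ^ (-1 - s)) * r ^ s := by
  rcases hr.eq_or_lt with rfl | hr
  · simp [Real.zero_rpow hs0.ne']
  have h := integral_comp_mul_left_Ioi' (fun l => (1 - Real.exp (-l)) * l ^ (-1 - s)) 0 hr
  rw [mul_zero] at h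
  rw [← h, smul_eq_mul, ← integral_const_mul, ← integral_mul_const]
  refine setIntegral_congr_fun measurableSet_Ioi fun l hl => ?_
  have hl0 : (0:ℝ) < l := hl
  have h1 : r * r ^ (-1 - s) * r ^ s = 1 := by
    rw [← Real.rpow_one_add' hr.le (by linarith), ← Real.rpow_add hr,
      show 1 + (-1 - s) + s = 0 by ring, Real.rpow_zero]
  rw [Real.mul_rpow hr.le hl0.le, mul_comm r l]
  linear_combination (-(1 - Real.exp (-(l * r))) * l ^ (-1 - s)) * h1

theorem integral_one_sub_exp_mul_rpow_pos {s : ℝ} (hs0 : 0 < s) (hs1 : s < 1) :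
    0 < ∫ l in Ioi (0 : ℝ), (1 - Real.exp (-l)) * l ^ (-1 - s) := by
  have hi := integrableOn_one_sub_exp_mul_rpow hs0 hs1 zero_le_one
  simp only [mul_one] at hi
  have hpos : ∀ l ∈ Ioi (0 : ℝ), 0 < (1 - Real.exp (-l)) * l ^ (-1 - s) := fun l hl => by
    have : Real.exp (-l) < 1 := Real.exp_lt_one_iff.2 (neg_lt_zero.2 hl)
    exact mul_pos (by linarith) (Real.rpow_pos_of_pos hl _)
  rw [setIntegral_pos_iff_support_of_nonneg_ae
    ((ae_restrict_mem measurableSet_Ioi).mono fun l hl => (hpos l hl).le) hi]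
  refine lt_of_lt_of_le ?_ (measure_mono (subset_inter (fun l hl => (hpos l hl).ne') subset_rfl))
  simp

/-- The Lévy measure `l^{-1-s} dl` is infinite near `0`. Restricted to `l > ε` it is finite, so `1`
and `e^{-lr}` can be integrated separately and `exp_laplace` applies; then `ε → 0`. -/
theorem isPosRadial_exp_neg_rpow {s : ℝ} (hs0 : 0 < s) (hs1 : s < 1) {c : ℝ} (hc : 0 < c) :
    IsPosRadial V (fun r => Real.exp (-(c * r ^ s))) := by
  set K := ∫ l in Ioi (0 : ℝ), (1 - Real.exp (-l)) * l ^ (-1 - s) with hK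
  have hK0 : 0 < K := integral_one_sub_exp_mul_rpow_pos hs0 hs1
  -- The factor `c / K` normalizes the density so that `∫ (1 - e^{-lr}) κ(l) dl = c r^s` over the
  -- half line.
  set κ : ℝ → ℝ := fun l => c / K * l ^ (-1 - s) with hκ
  have hκm : Measurable κ := by fun_prop
  set ε : ℕ → ℝ := fun k => 1 / ((k : ℝ) + 1) with hε
  have hε0 : ∀ k, 0 < ε k := fun k => Nat.one_div_pos_of_nat
  have hεlim : Tendsto ε atTop (𝓝 0) := tendsto_one_div_add_atTop_nhds_zero_nat
  have hκi : ∀ k, IntegrableOn κ (Ioi (ε k)) := fun k =>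
    (integrableOn_Ioi_rpow_of_lt (by linarith) (hε0 k)).const_mul _
  have hκ0 : ∀ l : ℝ, 0 < l → 0 ≤ κ l := fun l hl =>
    mul_nonneg (by positivity) (Real.rpow_nonneg hl.le _)
  have hpos := fun k => (IsPosRadial.exp_laplace (V := V) (hε0 k) hκm (hκi k)
    (fun l hl => hκ0 l ((hε0 k).trans hl))).const_mul
      (Real.exp_pos (-∫ l in Ioi (ε k), κ l)).le
  have hrw : ∀ k r, 0 ≤ r → Real.exp (-∫ l in Ioi (ε k), κ l) *
      Real.exp (∫ l in Ioi (ε k), Real.exp (-(l * r)) * κ l) =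
      Real.exp (-∫ l in Ioi (ε k), c / K * ((1 - Real.exp (-(l * r))) * l ^ (-1 - s))) := by
    intro k r hr
    rw [← Real.exp_add]
    congr 1
    have hi : IntegrableOn (fun l => Real.exp (-(l * r)) * κ l) (Ioi (ε k)) := by
      refine (hκi k).mono' (Measurable.aestronglyMeasurable (by fun_prop)) ?_
      filter_upwards [ae_restrict_mem measurableSet_Ioi] with l hl
      have hl0 : 0 < l := (hε0 k).trans hl
      rw [norm_mul, Real.norm_of_nonneg (hκ0 l hl0), Real.norm_eq_abs, Real.abs_exp]
      refine mul_le_of_le_one_left (hκ0 l hl0) (Real.exp_le_one_iff.2 ?_)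
      have := mul_nonneg hl0.le hr
      linarith
    have : (fun l => c / K * ((1 - Real.exp (-(l * r))) * l ^ (-1 - s))) =
      fun l => κ l - Real.exp (-(l * r)) * κ l := by ext l; simp only [hκ]; ring
    rw [this, integral_sub (hκi k) hi]
    ring
  refine IsPosRadial.of_tendsto hpos (by fun_prop) (C := 1) ?_ ?_
  · intro k r hr
    rw [hrw k r hr, Real.abs_exp, Real.exp_le_one_iff, neg_nonpos]
    refine setIntegral_nonneg measurableSet_Ioi fun l hl => ?_
    have hl0 : 0 < l := (hε0 k).trans hl
    refine mul_nonneg (by positivity) (mul_nonneg ?_ (Real.rpow_nonneg hl0.le _))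
    rw [sub_nonneg, Real.exp_le_one_iff]
    have := mul_nonneg hl0.le hr
    linarith
  · intro r hr
    simp only [hrw _ r hr]
    refine (Real.continuous_exp.tendsto _).comp (Tendsto.neg ?_)
    have hi := (integrableOn_one_sub_exp_mul_rpow hs0 hs1 hr).const_mul (c / K)
    have hcov := aecover_Ioi_of_Ioi (μ := (volume : Measure ℝ)) hεlim
    have hlim := hcov.integral_tendsto_of_countably_generated hi
    have hval : ∫ l in Ioi (0:ℝ), c / K * ((1 - Real.exp (-(l * r))) * l ^ (-1 - s)) =
        c * r ^ s := by
      rw [integral_const_mul, integral_one_sub_exp_mul_rpow hs0 hr, ← hK]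
      field_simp
    rw [hval] at hlim
    refine hlim.congr fun k => ?_
    rw [Measure.restrict_restrict measurableSet_Ioi,
      inter_eq_left.2 (Ioi_subset_Ioi (hε0 k).le)]

end StableDensity

/-! ### The fractional heat kernel: positivity, integrability, scaling. -/

section StableKernel

open scoped RealInnerProductSpace

variable {V : Type*} [NormedAddCommGroup V]

/-- The Fourier multiplier of the fractional heat semigroup at time `t`. -/
noncomputable def heatMultiplier (s t : ℝ) (ξ : V) : ℝ :=
  Real.exp (-(t * (2 * Real.pi * ‖ξ‖) ^ (2 * s)))

theorem continuous_two_pi_norm_rpow {s : ℝ} (hs0 : 0 < s) :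
    Continuous (fun ξ : V => (2 * Real.pi * ‖ξ‖) ^ (2 * s)) :=
  (by fun_prop : Continuous fun ξ : V => 2 * Real.pi * ‖ξ‖).rpow_const
    fun _ => Or.inr (by positivity)

theorem continuous_heatMultiplier {s : ℝ} (hs0 : 0 < s) (t : ℝ) :
    Continuous (heatMultiplier s t : V → ℝ) :=
  Real.continuous_exp.comp ((continuous_two_pi_norm_rpow hs0).const_mul t).neg

theorem heatMultiplier_pos (s t : ℝ) (ξ : V) : 0 < heatMultiplier s t ξ := Real.exp_pos _

theorem heatMultiplier_le_one (s : ℝ) {t : ℝ} (ht : 0 ≤ t) (ξ : V) : heatMultiplier s t ξ ≤ 1 := by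
  refine Real.exp_le_one_iff.2 (neg_nonpos.2 (mul_nonneg ht ?_))
  positivity

theorem heatMultiplier_neg (s t : ℝ) (ξ : V) : heatMultiplier s t (-ξ) = heatMultiplier s t ξ := by
  simp [heatMultiplier]

theorem heatMultiplier_eq_rpow_sq (s t : ℝ) (ξ : V) : heatMultiplier s t ξ =
    Real.exp (-(t * (2 * Real.pi) ^ (2 * s) * (‖ξ‖ ^ 2) ^ s)) := by
  rw [heatMultiplier, Real.mul_rpow (by positivity) (norm_nonneg _), mul_assoc,
    Real.rpow_mul (norm_nonneg _), Real.rpow_two]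

variable [InnerProductSpace ℝ V]

theorem heatMultiplier_scaling {s : ℝ} (hs0 : 0 < s) {t : ℝ} (ht : 0 < t) (ξ : V) :
    heatMultiplier s t ξ = heatMultiplier s 1 (t ^ (1 / (2 * s)) • ξ) := by
  simp only [heatMultiplier]
  have h0 : 0 < t ^ (1 / (2 * s)) := Real.rpow_pos_of_pos ht _
  rw [norm_smul, Real.norm_of_nonneg h0.le, mul_left_comm, Real.mul_rpow h0.le (by positivity),
    ← Real.rpow_mul ht.le, one_div_mul_cancel (by positivity), Real.rpow_one, one_mul]

variable [FiniteDimensional ℝ V] [MeasurableSpace V] [BorelSpace V]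

theorem integrable_heatMultiplier [Nontrivial V] {s : ℝ} (hs0 : 0 < s) {t : ℝ} (ht : 0 < t) :
    Integrable (heatMultiplier s t : V → ℝ) := by
  have h := integrableOn_rpow_mul_exp_neg_mul_rpow
    (s := ((Module.finrank ℝ V - 1 : ℕ) : ℝ)) (p := 2 * s) (b := t * (2 * Real.pi) ^ (2 * s))
    (by have : (0:ℝ) ≤ ((Module.finrank ℝ V - 1 : ℕ) : ℝ) := by positivity
        linarith) (by positivity) (by positivity)
  have h2 := (integrable_fun_norm_addHaar (volume : Measure V)
    (f := fun r => Real.exp (-(t * (2 * Real.pi) ^ (2 * s)) * r ^ (2 * s)))).2 (by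
      simpa [Real.rpow_natCast] using h)
  refine h2.congr (Eventually.of_forall fun ξ => ?_)
  simp only [heatMultiplier]
  rw [Real.mul_rpow (by positivity) (norm_nonneg _)]
  congr 1; ring

/-- The fractional heat kernel as a cosine transform. -/
noncomputable def stableKernel (s t : ℝ) (x : V) : ℝ :=
  ∫ ξ : V, heatMultiplier s t ξ * Real.cos (2 * Real.pi * ⟪ξ, x⟫)

theorem fourierInv_heatMultiplier [Nontrivial V] {s : ℝ} (hs0 : 0 < s) {t : ℝ} (ht : 0 < t) :
    𝓕⁻ (fun ξ : V => (heatMultiplier s t ξ : ℂ)) = fun x => (stableKernel s t x : ℂ) :=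
  funext fun x => fourierInv_ofReal_of_even (integrable_heatMultiplier hs0 ht)
    (heatMultiplier_neg s t) x

theorem continuous_stableKernel [Nontrivial V] {s : ℝ} (hs0 : 0 < s) {t : ℝ} (ht : 0 < t) :
    Continuous (stableKernel s t : V → ℝ) := by
  have h := continuous_fourierInv (integrable_heatMultiplier (V := V) hs0 ht).ofReal
  have h2 := Complex.continuous_re.comp h
  refine h2.congr fun x => ?_
  have := congrFun (fourierInv_heatMultiplier (V := V) hs0 ht) x
  simp only [Function.comp_apply]
  exact (congrArg Complex.re this).trans (Complex.ofReal_re _)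

/-- With damping `exp(-‖ξ‖²/(k+1))` the integral is nonnegative by `isPosRadial_exp_neg_rpow`; the
damping is removed by dominated convergence, the multiplier being integrable. -/
theorem stableKernel_nonneg [Nontrivial V] {s : ℝ} (hs0 : 0 < s) (hs1 : s < 1) {t : ℝ}
    (ht : 0 < t) (x : V) : 0 ≤ stableKernel s t x := by
  have hpos := isPosRadial_exp_neg_rpow (V := V) hs0 hs1
    (c := t * (2 * Real.pi) ^ (2 * s)) (by positivity)
  refine ge_of_tendsto (x := atTop) (f := fun k : ℕ => ∫ ξ : V, heatMultiplier s t ξ *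
      (Real.exp (-(1 / ((k : ℝ) + 1)) * ‖ξ‖ ^ 2) * Real.cos (2 * Real.pi * ⟪ξ, x⟫))) ?_
      (Eventually.of_forall fun k => ?_)
  · refine tendsto_integral_of_dominated_convergence (heatMultiplier s t)
      (fun k => ?_) (integrable_heatMultiplier hs0 ht)
      (fun k => Eventually.of_forall fun ξ => ?_) (Eventually.of_forall fun ξ => ?_)
    · have := continuous_heatMultiplier (V := V) hs0 t
      exact Continuous.aestronglyMeasurable (by fun_prop)
    · refine (norm_mul_exp_mul_cos_le (le_refl _) _ _).trans ?_
      rw [abs_of_pos (heatMultiplier_pos s t ξ)]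
      refine mul_le_of_le_one_right (heatMultiplier_pos s t ξ).le (Real.exp_le_one_iff.2 ?_)
      have : 0 ≤ 1 / ((k : ℝ) + 1) * ‖ξ‖ ^ 2 := by positivity
      linarith
    · have h1 : Tendsto (fun k : ℕ => -(1 / ((k : ℝ) + 1)) * ‖ξ‖ ^ 2) atTop (𝓝 (-0 * ‖ξ‖ ^ 2)) :=
        (tendsto_one_div_add_atTop_nhds_zero_nat.neg).mul_const _
      have h2 := ((Real.continuous_exp.tendsto _).comp h1).mul_const
        (Real.cos (2 * Real.pi * ⟪ξ, x⟫))
      have h3 := h2.const_mul (heatMultiplier s t ξ)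
      simpa using h3
  · simp only [heatMultiplier_eq_rpow_sq]
    exact hpos.nonneg _ Nat.one_div_pos_of_nat x

/-- The multiplication formula moves the transform onto the Gaussian, where it becomes a probability
density, while the multiplier is at most `1`. -/
theorem integral_stableKernel_mul_gaussian_le [Nontrivial V] {s : ℝ} (hs0 : 0 < s) {t : ℝ}
    (ht : 0 < t) {ε : ℝ} (hε : 0 < ε) :
    ∫ x : V, stableKernel s t x * Real.exp (-ε * ‖x‖ ^ 2) ≤ 1 := by
  have hg := integrable_exp_neg_mul_sq_norm (V := V) hε
  have hm := integrable_heatMultiplier (V := V) hs0 ht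
  have h1 := integral_fourierInv_mul_eq hm.ofReal (hg.ofReal (𝕜 := ℂ))
  have hG : 𝓕⁻ (fun x : V => ((Real.exp (-ε * ‖x‖ ^ 2) : ℝ) : ℂ)) =
      fun w => (((Real.pi / ε) ^ ((Module.finrank ℝ V : ℝ) / 2) *
        Real.exp (-(Real.pi ^ 2 / ε) * ‖w‖ ^ 2) : ℝ) : ℂ) := by
    ext w
    rw [Real.fourierInv_eq_fourier_neg]
    have h2 := _root_.fourier_gaussian_innerProductSpace (V := V)
      (show 0 < (ε : ℂ).re from hε) (-w)
    push_cast
    rw [h2, Complex.ofReal_cpow (by positivity), norm_neg]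
    push_cast
    congr 2
    ring
  have h1' : ∫ x : V, stableKernel s t x * Real.exp (-ε * ‖x‖ ^ 2) =
      ∫ w : V, heatMultiplier s t w * ((Real.pi / ε) ^ ((Module.finrank ℝ V : ℝ) / 2) *
        Real.exp (-(Real.pi ^ 2 / ε) * ‖w‖ ^ 2)) := by
    have h3 : ∫ x : V, ((stableKernel s t x * Real.exp (-ε * ‖x‖ ^ 2) : ℝ) : ℂ) =
        ∫ w : V, ((heatMultiplier s t w * ((Real.pi / ε) ^ ((Module.finrank ℝ V : ℝ) / 2) *
          Real.exp (-(Real.pi ^ 2 / ε) * ‖w‖ ^ 2)) : ℝ) : ℂ) := by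
      have hK := fourierInv_heatMultiplier (V := V) hs0 ht
      erw [hK, hG] at h1
      simp only [Complex.ofReal_mul] at h1 ⊢
      exact h1
    rw [integral_complex_ofReal, integral_complex_ofReal] at h3
    exact Complex.ofReal_inj.1 h3
  have hg2 := integrable_exp_neg_mul_sq_norm (V := V) (δ := Real.pi ^ 2 / ε) (by positivity)
  rw [h1']
  calc _ ≤ ∫ w : V, (Real.pi / ε) ^ ((Module.finrank ℝ V : ℝ) / 2) *
        Real.exp (-(Real.pi ^ 2 / ε) * ‖w‖ ^ 2) := by
        refine integral_mono ((hg2.const_mul _).bdd_mul (c := 1)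
          (continuous_heatMultiplier hs0 t).aestronglyMeasurable (Eventually.of_forall fun w => ?_))
          (hg2.const_mul _) fun w => ?_
        · rw [Real.norm_of_nonneg (heatMultiplier_pos _ _ _).le]
          exact heatMultiplier_le_one s ht.le w
        · exact mul_le_of_le_one_left (by positivity) (heatMultiplier_le_one s ht.le w)
    _ = 1 := by
      rw [integral_const_mul, GaussianFourier.integral_rexp_neg_mul_sq_norm (by positivity),
        ← Real.mul_rpow (by positivity) (by positivity)]
      rw [show Real.pi / ε * (Real.pi / (Real.pi ^ 2 / ε)) = 1 by field_simp, Real.one_rpow]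

/-- Since the kernel is nonnegative, Fatou's lemma passes the bound on the damped masses to the full
integral. -/
theorem integrable_stableKernel [Nontrivial V] {s : ℝ} (hs0 : 0 < s) (hs1 : s < 1) {t : ℝ}
    (ht : 0 < t) : Integrable (stableKernel s t : V → ℝ) := by
  have hc := continuous_stableKernel (V := V) hs0 ht
  have h0 := stableKernel_nonneg (V := V) hs0 hs1 ht
  refine ⟨hc.aestronglyMeasurable, ?_⟩
  rw [hasFiniteIntegral_iff_ofReal (Eventually.of_forall h0)]
  have hlim : ∀ x : V, Tendsto (fun k : ℕ => ENNReal.ofReal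
      (stableKernel s t x * Real.exp (-(1 / ((k : ℝ) + 1)) * ‖x‖ ^ 2))) atTop
      (𝓝 (ENNReal.ofReal (stableKernel s t x))) := fun x => by
    refine (ENNReal.continuous_ofReal.tendsto _).comp ?_
    have h1 : Tendsto (fun k : ℕ => -(1 / ((k : ℝ) + 1)) * ‖x‖ ^ 2) atTop (𝓝 (-0 * ‖x‖ ^ 2)) :=
      (tendsto_one_div_add_atTop_nhds_zero_nat.neg).mul_const _
    simpa using ((Real.continuous_exp.tendsto _).comp h1).const_mul (stableKernel s t x)
  calc ∫⁻ x : V, ENNReal.ofReal (stableKernel s t x)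
      = ∫⁻ x : V, liminf (fun k : ℕ => ENNReal.ofReal
          (stableKernel s t x * Real.exp (-(1 / ((k : ℝ) + 1)) * ‖x‖ ^ 2))) atTop :=
        lintegral_congr fun x => (hlim x).liminf_eq.symm
    _ ≤ liminf (fun k : ℕ => ∫⁻ x : V, ENNReal.ofReal
          (stableKernel s t x * Real.exp (-(1 / ((k : ℝ) + 1)) * ‖x‖ ^ 2))) atTop :=
        lintegral_liminf_le fun k => by fun_prop
    _ ≤ 1 := by
      refine liminf_le_of_frequently_le' (Frequently.of_forall fun k => ?_)
      have hk : (0:ℝ) < 1 / ((k : ℝ) + 1) := Nat.one_div_pos_of_nat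
      rw [← ofReal_integral_eq_lintegral_ofReal]
      · rw [ENNReal.ofReal_le_one]
        exact integral_stableKernel_mul_gaussian_le hs0 ht hk
      · refine (integrable_exp_neg_mul_sq_norm hk).bdd_mul
          (c := ∫ ξ : V, ‖(heatMultiplier s t ξ : ℂ)‖) hc.aestronglyMeasurable
          (Eventually.of_forall fun x => ?_)
        have h2 := norm_fourierInv_le (fun ξ : V => (heatMultiplier s t ξ : ℂ)) x
        rw [fourierInv_heatMultiplier hs0 ht, Complex.norm_real] at h2
        exact h2
      · exact Eventually.of_forall fun x => mul_nonneg (h0 x) (Real.exp_pos _).le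
    _ < ⊤ := ENNReal.one_lt_top

theorem fourier_stableKernel [Nontrivial V] {s : ℝ} (hs0 : 0 < s) (hs1 : s < 1) {t : ℝ}
    (ht : 0 < t) :
    𝓕 (fun x : V => (stableKernel s t x : ℂ)) = fun ξ => (heatMultiplier s t ξ : ℂ) := by
  rw [← fourierInv_heatMultiplier hs0 ht]
  refine Continuous.fourier_fourierInv_eq ?_ (integrable_heatMultiplier hs0 ht).ofReal ?_
  · exact Complex.continuous_ofReal.comp (continuous_heatMultiplier hs0 t)
  · have h := (integrable_stableKernel (V := V) hs0 hs1 ht).ofReal (𝕜 := ℂ)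
    refine h.comp_neg.congr (Eventually.of_forall fun ξ => ?_)
    have h2 := congrFun (fourierInv_heatMultiplier (V := V) hs0 ht) (-ξ)
    rw [Real.fourierInv_eq_fourier_neg, neg_neg] at h2
    exact h2.symm

theorem stableKernel_scaling {s : ℝ} (hs0 : 0 < s) {t : ℝ} (ht : 0 < t) (x : V) :
    stableKernel s t x = ((t ^ (1 / (2 * s))) ^ Module.finrank ℝ V)⁻¹ *
      stableKernel s 1 ((t ^ (1 / (2 * s)))⁻¹ • x) := by
  have h0 : 0 < t ^ (1 / (2 * s)) := Real.rpow_pos_of_pos ht _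
  have h := Measure.integral_comp_smul (volume : Measure V) (fun ξ => heatMultiplier s 1 ξ *
    Real.cos (2 * Real.pi * ⟪ξ, (t ^ (1 / (2 * s)))⁻¹ • x⟫)) (t ^ (1 / (2 * s)))
  rw [abs_of_pos (by positivity), smul_eq_mul] at h
  rw [stableKernel, stableKernel, ← h]
  congr 1; ext ξ
  rw [← heatMultiplier_scaling hs0 ht, real_inner_smul_left, real_inner_smul_right,
    mul_inv_cancel_left₀ h0.ne']

end StableKernel

/-! ### Interpolation, and decay of `P_t * v - (∫ v) P_t`. -/

section Asymptotics

open scoped RealInnerProductSpace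

/-- Integrate `|f|^p ≤ |f| ‖f‖_∞^{p-1}` and take the `p`-th root. -/
theorem eLpNorm_le_eLpNorm_one_rpow_mul_eLpNorm_top_rpow {α E : Type*} [MeasurableSpace α]
    {μ : Measure α} [NormedAddCommGroup E] {f : α → E} (hf : AEStronglyMeasurable f μ)
    {p : ENNReal} (hp : 1 ≤ p) (hp' : p ≠ ⊤) :
    eLpNorm f p μ ≤ eLpNorm f 1 μ ^ (p⁻¹).toReal * eLpNorm f ⊤ μ ^ (1 - (p⁻¹).toReal) := by
  have hp0 : p ≠ 0 := (zero_lt_one.trans_le hp).ne'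
  have hp1 : 1 ≤ p.toReal := by
    simpa using (ENNReal.toReal_le_toReal ENNReal.one_ne_top hp').2 hp
  have hpos : 0 < p.toReal := by linarith
  rw [eLpNorm_eq_lintegral_rpow_enorm_toReal hp0 hp', eLpNorm_one_eq_lintegral_enorm,
    ENNReal.toReal_inv, one_div]
  have h1 : ∫⁻ x, ‖f x‖ₑ ^ p.toReal ∂μ ≤
      (∫⁻ x, ‖f x‖ₑ ∂μ) * eLpNorm f ⊤ μ ^ (p.toReal - 1) := by
    rw [← lintegral_mul_const'' _ hf.enorm]
    refine lintegral_mono_ae ?_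
    filter_upwards [ae_le_eLpNormEssSup (f := f) (μ := μ)] with x hx
    calc ‖f x‖ₑ ^ p.toReal = ‖f x‖ₑ ^ (1 + (p.toReal - 1)) := by congr 1; ring
      _ = ‖f x‖ₑ * ‖f x‖ₑ ^ (p.toReal - 1) := by
        rw [ENNReal.rpow_add_of_nonneg _ _ zero_le_one (by linarith), ENNReal.rpow_one]
      _ ≤ _ := mul_le_mul' le_rfl
        (ENNReal.rpow_le_rpow (by rwa [eLpNorm_exponent_top]) (by linarith))
  refine (ENNReal.rpow_le_rpow h1 (by positivity)).trans (le_of_eq ?_)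
  rw [ENNReal.mul_rpow_of_nonneg _ _ (by positivity), ← ENNReal.rpow_mul]
  congr 2
  field_simp

/-- Interpolation between weighted decay in `L¹` and in `L^∞`. -/
theorem tendsto_weighted_eLpNorm {α E : Type*} [MeasurableSpace α]
    {μ : Measure α} [NormedAddCommGroup E] {f : ℝ → α → E}
    (hf : ∀ᶠ t in atTop, AEStronglyMeasurable (f t) μ) {a : ℝ}
    (h1 : Tendsto (fun t => eLpNorm (f t) 1 μ) atTop (𝓝 0))
    (htop : Tendsto (fun t : ℝ => ENNReal.ofReal (t ^ a) * eLpNorm (f t) ⊤ μ) atTop (𝓝 0))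
    {p : ENNReal} (hp : 1 ≤ p) :
    Tendsto (fun t : ℝ => ENNReal.ofReal (t ^ (a * (1 - (p⁻¹).toReal))) * eLpNorm (f t) p μ)
      atTop (𝓝 0) := by
  -- The endpoints are separated because there one of the exponents `q`, `1 - q` is zero, and its
  -- factor would no longer tend to `0`.
  rcases eq_or_ne p ⊤ with rfl | hp'
  · simpa using htop
  rcases eq_or_ne p 1 with rfl | hp1
  · simpa using h1
  set q := (p⁻¹).toReal with hq
  have hp1 : 1 < p := lt_of_le_of_ne hp hp1.symm
  have hq0 : 0 < q := ENNReal.toReal_pos (ENNReal.inv_ne_zero.2 hp')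
    (ENNReal.inv_ne_top.2 (zero_lt_one.trans hp1).ne')
  have hq1 : q < 1 := by
    have : p⁻¹ < 1 := ENNReal.inv_lt_one.2 hp1
    exact ((ENNReal.toReal_lt_toReal this.ne_top ENNReal.one_ne_top).2 this).trans_eq
      ENNReal.toReal_one
  have hlim : Tendsto (fun t : ℝ => eLpNorm (f t) 1 μ ^ q *
      (ENNReal.ofReal (t ^ a) * eLpNorm (f t) ⊤ μ) ^ (1 - q)) atTop (𝓝 0) := by
    have h2 := (ENNReal.continuous_rpow_const (y := q)).tendsto 0 |>.comp h1
    have h3 := (ENNReal.continuous_rpow_const (y := 1 - q)).tendsto 0 |>.comp htop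
    rw [ENNReal.zero_rpow_of_pos hq0] at h2
    rw [ENNReal.zero_rpow_of_pos (by linarith)] at h3
    simpa using ENNReal.Tendsto.mul h2 (Or.inr ENNReal.zero_ne_top) h3
      (Or.inr ENNReal.zero_ne_top)
  refine tendsto_of_tendsto_of_tendsto_of_le_of_le' tendsto_const_nhds hlim
    (Eventually.of_forall fun _ => zero_le) ?_
  filter_upwards [hf, eventually_gt_atTop 0] with t hft ht
  rw [ENNReal.mul_rpow_of_nonneg _ _ (by linarith), Real.rpow_mul ht.le,
    ← ENNReal.ofReal_rpow_of_nonneg (by positivity) (by linarith), mul_left_comm]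
  gcongr
  exact eLpNorm_le_eLpNorm_one_rpow_mul_eLpNorm_top_rpow hft hp hp'

theorem tendsto_rpow_inv_smul {V : Type*} [NormedAddCommGroup V]
    [NormedSpace ℝ V] {s : ℝ} (hs0 : 0 < s) (y : V) :
    Tendsto (fun t : ℝ => (t ^ (1 / (2 * s)))⁻¹ • y) atTop (𝓝 0) := by
  have h := (tendsto_rpow_atTop (y := 1 / (2 * s)) (by positivity)).inv_tendsto_atTop
  simpa using h.smul_const y

variable {V : Type*} [NormedAddCommGroup V] [InnerProductSpace ℝ V] [FiniteDimensional ℝ V]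
  [MeasurableSpace V] [BorelSpace V]

/-- Continuity of translations in `L¹` at a nonnegative continuous function. -/
theorem tendsto_integral_norm_translate_sub {k : V → ℝ} (hk : Integrable k) (hc : Continuous k)
    (h0 : ∀ x, 0 ≤ k x) :
    Tendsto (fun h => ∫ x, ‖k (x - h) - k x‖) (𝓝 0) (𝓝 0) := by
  -- Scheffé's argument: `|a - b| = (a - b) + 2 (b - a)⁺` with `a` the translate. The first term
  -- integrates to zero by translation invariance, and the positive part is at most `k x` because
  -- the translate is nonnegative.
  have hlim : Tendsto (fun h => ∫ x, 2 * max (k x - k (x - h)) 0) (𝓝 0)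
      (𝓝 (∫ x : V, 2 * max (k x - k (x - 0)) 0)) := by
    refine tendsto_integral_filter_of_dominated_convergence (fun x => 2 * k x)
      (Eventually.of_forall fun h => ?_) (Eventually.of_forall fun h =>
        Eventually.of_forall fun x => ?_) (hk.const_mul 2) (Eventually.of_forall fun x => ?_)
    · exact Continuous.aestronglyMeasurable (by fun_prop)
    · rw [Real.norm_of_nonneg (by positivity)]
      have := h0 (x - h)
      have := h0 x
      gcongr
      exact max_le (by linarith) (by linarith)
    · exact Continuous.tendsto (f := fun h => 2 * max (k x - k (x - h)) 0) (by fun_prop) 0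
  simp only [sub_zero, sub_self, max_self, mul_zero, integral_zero] at hlim
  refine hlim.congr fun h => ?_
  have hkh : Integrable (fun x => k (x - h)) := hk.comp_sub_right h
  have : ∀ x, ‖k (x - h) - k x‖ = (k (x - h) - k x) + 2 * max (k x - k (x - h)) 0 := by
    intro x
    rw [Real.norm_eq_abs]
    rcases le_total (k x) (k (x - h)) with h1 | h1
    · rw [abs_of_nonneg (by linarith), max_eq_right (by linarith)]; ring
    · rw [abs_of_nonpos (by linarith), max_eq_left (by linarith)]; ring
  have hi1 : Integrable (fun x => k (x - h) - k x) := hkh.sub hk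
  have hi2 : Integrable (fun x => 2 * max (k x - k (x - h)) 0) :=
    (hk.sub hkh).pos_part.const_mul 2
  simp_rw [this]
  rw [integral_add hi1 hi2, integral_sub hkh hk,
    integral_sub_right_eq_self (fun x => k x)]
  ring

theorem integral_norm_stableKernel_translate_sub {s : ℝ} (hs0 : 0 < s) {t : ℝ} (ht : 0 < t)
    (y : V) :
    ∫ x : V, ‖stableKernel s t (x - y) - stableKernel s t x‖ =
      ∫ x : V, ‖stableKernel s 1 (x - (t ^ (1 / (2 * s)))⁻¹ • y) - stableKernel s 1 x‖ := by
  have h0 : 0 < t ^ (1 / (2 * s)) := Real.rpow_pos_of_pos ht _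
  have h := Measure.integral_comp_inv_smul_of_nonneg (volume : Measure V) (fun x =>
    ‖stableKernel s 1 (x - (t ^ (1 / (2 * s)))⁻¹ • y) - stableKernel s 1 x‖) h0.le
  have h2 : ∀ x : V, ‖stableKernel s t (x - y) - stableKernel s t x‖ =
      ((t ^ (1 / (2 * s))) ^ Module.finrank ℝ V)⁻¹ *
      ‖stableKernel s 1 ((t ^ (1 / (2 * s)))⁻¹ • x - (t ^ (1 / (2 * s)))⁻¹ • y) -
        stableKernel s 1 ((t ^ (1 / (2 * s)))⁻¹ • x)‖ := by
    intro x
    rw [stableKernel_scaling hs0 ht, stableKernel_scaling hs0 ht x, ← mul_sub, norm_mul,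
      Real.norm_of_nonneg (by positivity), smul_sub]
  simp_rw [h2]
  rw [integral_const_mul, h, smul_eq_mul, inv_mul_cancel_left₀ (by positivity)]

variable [Nontrivial V]

theorem fourierInv_heatMultiplier_mul_fourier {s : ℝ} (hs0 : 0 < s) {t : ℝ} (ht : 0 < t)
    {v : V → ℝ} (hv : Integrable v) (x : V) :
    𝓕⁻ (fun ξ => (heatMultiplier s t ξ : ℂ) * 𝓕 (fun y => (v y : ℂ)) ξ) x =
      ((∫ y, v y * stableKernel s t (x - y) : ℝ) : ℂ) := by
  have hm := (integrable_heatMultiplier (V := V) hs0 ht).complex_ofReal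
  -- Modulating the multiplier by the frequency `x` gives a function whose transform is `y ↦ P_t(x -
  -- y)`, so the convolution formula is an instance of the multiplication formula.
  set g : V → ℂ := fun ξ => Complex.exp (↑(2 * Real.pi * ⟪ξ, x⟫) * Complex.I) *
    (heatMultiplier s t ξ : ℂ) with hg
  have hgi : Integrable g := by
    refine hm.bdd_mul (c := 1) (Continuous.aestronglyMeasurable (by fun_prop))
      (Eventually.of_forall fun ξ => ?_)
    rw [Complex.norm_exp_ofReal_mul_I]
  have hFg : ∀ y, 𝓕 g y = (stableKernel s t (x - y) : ℂ) := by
    intro y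
    rw [← congrFun (fourierInv_heatMultiplier (V := V) hs0 ht) (x - y), Real.fourier_eq',
      Real.fourierInv_eq']
    congr 1; ext ξ
    simp only [hg, smul_eq_mul]
    rw [← mul_assoc, ← Complex.exp_add]
    congr 2
    rw [inner_sub_right]
    push_cast
    ring
  have h := integral_fourier_mul_eq hv.complex_ofReal hgi
  simp only [hFg] at h
  rw [Real.fourierInv_eq', ← integral_complex_ofReal]
  simp only [Complex.ofReal_mul]
  refine Eq.trans ?_ h
  congr 1; ext ξ
  simp only [smul_eq_mul, hg, Complex.ofReal_mul]
  ring

variable {s : ℝ} {t : ℝ} {v w : V → ℝ}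

theorem bounded_stableKernel (hs0 : 0 < s) (ht : 0 < t) (x : V) :
    ‖stableKernel s t x‖ ≤ ∫ ξ : V, ‖(heatMultiplier s t ξ : ℂ)‖ := by
  have h2 := norm_fourierInv_le (fun ξ : V => (heatMultiplier s t ξ : ℂ)) x
  rwa [fourierInv_heatMultiplier hs0 ht, Complex.norm_real] at h2

theorem integrable_heatMultiplier_mul_fourier (hs0 : 0 < s) (ht : 0 < t) (hv : Integrable v) :
    Integrable (fun ξ => (heatMultiplier s t ξ : ℂ) * 𝓕 (fun y => (v y : ℂ)) ξ) :=
  (integrable_heatMultiplier hs0 ht).complex_ofReal.mul_bdd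
    (continuous_fourier hv.complex_ofReal).aestronglyMeasurable
    (Eventually.of_forall fun ξ => norm_fourier_le _ ξ)

/-- A function whose Fourier transform is evolved by the heat multiplier is the convolution with
the kernel. -/
theorem ae_eq_integral_stableKernel (hs0 : 0 < s) (ht : 0 < t)
    (hv : Integrable v) (hw : Integrable w)
    (hvw : ∀ ξ, 𝓕 (fun y => (w y : ℂ)) ξ = heatMultiplier s t ξ * 𝓕 (fun y => (v y : ℂ)) ξ) :
    ∀ᵐ x, w x = ∫ y, v y * stableKernel s t (x - y) := by
  have hF : 𝓕 (fun y => (w y : ℂ)) =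
      fun ξ => (heatMultiplier s t ξ : ℂ) * 𝓕 (fun y => (v y : ℂ)) ξ := funext hvw
  have h := fourierInv_fourier_ae_eq hw.complex_ofReal
    (hF ▸ integrable_heatMultiplier_mul_fourier hs0 ht hv)
  filter_upwards [h] with x hx
  have h2 := fourierInv_heatMultiplier_mul_fourier hs0 ht hv x
  rw [← hF] at h2
  exact Complex.ofReal_inj.1 (hx.symm.trans h2)

/-- Putting the mass under the integral writes the difference as `∫ v(y) (P_t(x - y) - P_t(x)) dy`.
Tonelli bounds its norm, and scaling trades large `t` for a small translation of `P_1`. -/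
theorem eLpNorm_one_sub_mul_stableKernel_le (hs0 : 0 < s) (hs1 : s < 1) (ht : 0 < t)
    (hv : Integrable v) (hw : Integrable w)
    (hvw : ∀ ξ, 𝓕 (fun y => (w y : ℂ)) ξ = heatMultiplier s t ξ * 𝓕 (fun y => (v y : ℂ)) ξ) :
    eLpNorm (fun x => w x - (∫ y, v y) * stableKernel s t x) 1 volume ≤
      ∫⁻ y : V, ‖v y‖ₑ * ENNReal.ofReal (∫ x : V,
        ‖stableKernel s 1 (x - (t ^ (1 / (2 * s)))⁻¹ • y) - stableKernel s 1 x‖) := by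
  have hk := integrable_stableKernel (V := V) hs0 hs1 ht
  have hc := continuous_stableKernel (V := V) hs0 ht
  rw [eLpNorm_one_eq_lintegral_enorm]
  calc ∫⁻ x, ‖w x - (∫ y, v y) * stableKernel s t x‖ₑ
      ≤ ∫⁻ x, ∫⁻ y, ‖v y‖ₑ * ‖stableKernel s t (x - y) - stableKernel s t x‖ₑ := by
        refine lintegral_mono_ae ?_
        filter_upwards [ae_eq_integral_stableKernel hs0 ht hv hw hvw] with x hx
        have h1 : Integrable (fun y => v y * stableKernel s t (x - y)) :=
          hv.mul_bdd (Continuous.aestronglyMeasurable (by fun_prop))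
            (Eventually.of_forall fun y => bounded_stableKernel hs0 ht _)
        rw [hx, ← integral_mul_const, ← integral_sub h1 (hv.mul_const _)]
        refine (enorm_integral_le_lintegral_enorm _).trans (le_of_eq ?_)
        congr 1; ext y
        rw [← mul_sub, enorm_mul]
    _ = ∫⁻ y, ∫⁻ x, ‖v y‖ₑ * ‖stableKernel s t (x - y) - stableKernel s t x‖ₑ := by
        refine lintegral_lintegral_swap ?_
        simp only [Function.uncurry_def]
        refine AEMeasurable.mul (M := ENNReal) ?_ ?_
        · exact hv.aestronglyMeasurable.enorm.comp_quasiMeasurePreserving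
            Measure.quasiMeasurePreserving_snd
        · exact (Continuous.measurable (by fun_prop)).aemeasurable
    _ = _ := by
        congr 1; ext y
        have hm : Measurable fun x => ‖stableKernel s t (x - y) - stableKernel s t x‖ₑ :=
          (Continuous.measurable (by fun_prop))
        have hi : Integrable fun x => stableKernel s t (x - y) - stableKernel s t x :=
          (hk.comp_sub_right y).sub hk
        rw [lintegral_const_mul _ hm, ← integral_norm_stableKernel_translate_sub hs0 ht,
          ofReal_integral_norm_eq_lintegral_enorm hi]

theorem tendsto_lintegral_enorm_mul_translate (hs0 : 0 < s) (hs1 : s < 1) (hv : Integrable v) :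
    Tendsto (fun t : ℝ => ∫⁻ y : V, ‖v y‖ₑ * ENNReal.ofReal (∫ x : V,
        ‖stableKernel s 1 (x - (t ^ (1 / (2 * s)))⁻¹ • y) - stableKernel s 1 x‖))
      atTop (𝓝 0) := by
  have hk := integrable_stableKernel (V := V) hs0 hs1 one_pos
  have hc := continuous_stableKernel (V := V) hs0 one_pos
  have h0 := tendsto_integral_norm_translate_sub hk hc (stableKernel_nonneg hs0 hs1 one_pos)
  have hlim : Tendsto (fun t : ℝ => ∫⁻ y : V, ‖v y‖ₑ * ENNReal.ofReal (∫ x : V,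
        ‖stableKernel s 1 (x - (t ^ (1 / (2 * s)))⁻¹ • y) - stableKernel s 1 x‖))
      atTop (𝓝 (∫⁻ _ : V, 0)) := by
    refine tendsto_lintegral_filter_of_dominated_convergence'
      (fun y => ‖v y‖ₑ * ENNReal.ofReal (2 * ∫ x : V, ‖stableKernel s 1 x‖))
      (Eventually.of_forall fun t => ?_) (Eventually.of_forall fun t =>
        Eventually.of_forall fun y => ?_) ?_ (Eventually.of_forall fun y => ?_)
    · refine hv.aestronglyMeasurable.enorm.mul ?_
      refine (ENNReal.measurable_ofReal.comp ?_).aemeasurable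
      refine (StronglyMeasurable.integral_prod_right (f := fun (y x : V) =>
        ‖stableKernel s 1 (x - (t ^ (1 / (2 * s)))⁻¹ • y) - stableKernel s 1 x‖) ?_).measurable
      simp only [Function.uncurry_def]
      exact Continuous.stronglyMeasurable (by fun_prop)
    · gcongr
      have h1 := hk.comp_sub_right ((t ^ (1 / (2 * s)))⁻¹ • y)
      calc _ ≤ ∫ x : V, (‖stableKernel s 1 (x - (t ^ (1 / (2 * s)))⁻¹ • y)‖ +
            ‖stableKernel s 1 x‖) :=
            integral_mono (h1.sub hk).norm (h1.norm.add hk.norm) fun x => norm_sub_le _ _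
        _ = _ := by
            rw [integral_add h1.norm hk.norm,
              integral_sub_right_eq_self (fun x : V => ‖stableKernel s 1 x‖)]
            ring
    · rw [lintegral_mul_const'' _ hv.aestronglyMeasurable.enorm]
      exact ENNReal.mul_ne_top hv.2.ne ENNReal.ofReal_ne_top
    · have h2 := (ENNReal.continuous_ofReal.tendsto _).comp
        (h0.comp (tendsto_rpow_inv_smul hs0 y))
      rw [ENNReal.ofReal_zero] at h2
      simpa using ENNReal.Tendsto.const_mul h2 (Or.inr enorm_ne_top)
  simpa using hlim

/-- The mass is the transform `F` at frequency `0`, so the difference has transform `heatMultiplier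
s t ξ * (F ξ - F 0)`. Its `L¹` norm bounds the supremum, and rescaling the frequency absorbs exactly
the weight `t^{n/(2s)}`. -/
theorem eLpNorm_top_sub_mul_stableKernel_le (hs0 : 0 < s) (hs1 : s < 1) (ht : 0 < t)
    (hv : Integrable v) (hw : Integrable w)
    (hvw : ∀ ξ, 𝓕 (fun y => (w y : ℂ)) ξ = heatMultiplier s t ξ * 𝓕 (fun y => (v y : ℂ)) ξ) :
    ENNReal.ofReal (t ^ ((Module.finrank ℝ V : ℝ) / (2 * s))) *
      eLpNorm (fun x => w x - (∫ y, v y) * stableKernel s t x) ⊤ volume ≤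
      ENNReal.ofReal (∫ ξ : V, heatMultiplier s 1 ξ *
        ‖𝓕 (fun y => (v y : ℂ)) ((t ^ (1 / (2 * s)))⁻¹ • ξ) - 𝓕 (fun y => (v y : ℂ)) 0‖) := by
  have hk := integrable_stableKernel (V := V) hs0 hs1 ht
  set r := t ^ (1 / (2 * s)) with hr
  have hr0 : 0 < r := Real.rpow_pos_of_pos ht _
  set F := 𝓕 (fun y => (v y : ℂ)) with hFdef
  set G : V → ℂ := fun ξ => heatMultiplier s t ξ * (F ξ - F 0) with hG
  have hF0 : F 0 = ((∫ y, v y : ℝ) : ℂ) := by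
    rw [hFdef, Real.fourier_eq', ← integral_complex_ofReal]
    simp
  have hGi : Integrable G := by
    have h1 := integrable_heatMultiplier_mul_fourier hs0 ht hv
    have h2 := ((integrable_heatMultiplier (V := V) hs0 ht).complex_ofReal).mul_const (F 0)
    refine (h1.sub h2).congr (Eventually.of_forall fun ξ => ?_)
    simp only [hG, Pi.sub_apply]
    exact (mul_sub _ _ _).symm
  have hd : Integrable (fun x => w x - (∫ y, v y) * stableKernel s t x) := hw.sub (hk.const_mul _)
  have hFd : 𝓕 (fun x => ((w x - (∫ y, v y) * stableKernel s t x : ℝ) : ℂ)) = G := by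
    ext ξ
    have e1 : (fun x => ((w x - (∫ y, v y) * stableKernel s t x : ℝ) : ℂ)) =
        (fun x => (w x : ℂ)) - (F 0) • (fun x => (stableKernel s t x : ℂ)) := by
      ext x; simp [hF0]
    have hi : ∀ {f : V → ℂ}, Integrable f → Integrable (fun x => Real.fourierChar (-⟪x, ξ⟫) • f x) :=
      fun hf => (Real.fourierIntegral_convergent_iff ξ).2 hf
    have e2 := congrFun (fourier_stableKernel (V := V) hs0 hs1 ht) ξ
    rw [e1]
    simp only [Real.fourier_eq, Pi.sub_apply, Pi.smul_apply, smul_sub] at e2 ⊢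
    have hi2 : Integrable fun x => Real.fourierChar (-⟪x, ξ⟫) • F 0 • (stableKernel s t x : ℂ) :=
      hi (hk.complex_ofReal.smul (F 0))
    rw [integral_sub (hi hw.complex_ofReal) hi2]
    have e3 := hvw ξ
    rw [Real.fourier_eq] at e3
    rw [e3]
    simp_rw [smul_comm _ (F 0)]
    rw [integral_smul, e2, hG, smul_eq_mul]
    ring
  have hae := fourierInv_fourier_ae_eq hd.complex_ofReal (hFd ▸ hGi)
  have hsc : r ^ Module.finrank ℝ V * ∫ ξ, ‖G ξ‖ =
      ∫ ξ : V, heatMultiplier s 1 ξ * ‖F (r⁻¹ • ξ) - F 0‖ := by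
    have h := Measure.integral_comp_inv_smul_of_nonneg (volume : Measure V)
      (fun ξ => ‖G ξ‖) hr0.le
    rw [smul_eq_mul] at h
    rw [← h]
    congr 1; ext ξ
    simp only [hG]
    rw [norm_mul, Complex.norm_real, Real.norm_of_nonneg (heatMultiplier_pos _ _ _).le,
      heatMultiplier_scaling hs0 ht, smul_inv_smul₀ hr0.ne']
  have hrn : t ^ ((Module.finrank ℝ V : ℝ) / (2 * s)) = r ^ Module.finrank ℝ V := by
    rw [hr, ← Real.rpow_natCast, ← Real.rpow_mul ht.le]
    congr 1; ring
  rw [← hsc, hrn, ENNReal.ofReal_mul (by positivity)]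
  gcongr
  rw [eLpNorm_exponent_top]
  refine eLpNormEssSup_le_of_ae_bound ?_
  filter_upwards [hae] with x hx
  have h3 := norm_fourierInv_le G x
  rw [hFd] at hx
  rw [hx, Complex.norm_real] at h3
  exact h3

theorem tendsto_integral_heatMultiplier_mul (hs0 : 0 < s) (hv : Integrable v) :
    Tendsto (fun t : ℝ => ENNReal.ofReal (∫ ξ : V, heatMultiplier s 1 ξ *
      ‖𝓕 (fun y => (v y : ℂ)) ((t ^ (1 / (2 * s)))⁻¹ • ξ) - 𝓕 (fun y => (v y : ℂ)) 0‖))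
      atTop (𝓝 0) := by
  have hFc := continuous_fourier hv.complex_ofReal
  have hFb := norm_fourier_le (fun y => (v y : ℂ))
  set F := 𝓕 (fun y => (v y : ℂ)) with hFdef
  have hm := continuous_heatMultiplier (V := V) hs0 1
  have hlim : Tendsto (fun t : ℝ => ∫ ξ : V, heatMultiplier s 1 ξ *
      ‖F ((t ^ (1 / (2 * s)))⁻¹ • ξ) - F 0‖) atTop (𝓝 (∫ _ : V, 0)) := by
    refine tendsto_integral_filter_of_dominated_convergence
      (fun ξ => heatMultiplier s 1 ξ * (2 * ∫ y, ‖(v y : ℂ)‖)) (Eventually.of_forall fun t => ?_)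
      (Eventually.of_forall fun t => Eventually.of_forall fun ξ => ?_)
      ((integrable_heatMultiplier hs0 one_pos).mul_const _) (Eventually.of_forall fun ξ => ?_)
    · refine Continuous.aestronglyMeasurable (hm.mul ?_)
      exact ((hFc.comp (continuous_const_smul _)).sub continuous_const).norm
    · rw [norm_mul, norm_norm, Real.norm_of_nonneg (heatMultiplier_pos _ _ _).le]
      refine mul_le_mul_of_nonneg_left ?_ (heatMultiplier_pos _ _ _).le
      refine (norm_sub_le _ _).trans ?_
      have h1 := hFb ((t ^ (1 / (2 * s)))⁻¹ • ξ)
      have h2 := hFb 0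
      linarith
    · have h1 := ((hFc.tendsto 0).comp (tendsto_rpow_inv_smul hs0 ξ)).sub_const (F 0)
      have h2 := (h1.norm).const_mul (heatMultiplier s 1 ξ)
      rw [sub_self, norm_zero, mul_zero] at h2
      exact h2
  have h3 := (ENNReal.continuous_ofReal.tendsto _).comp hlim
  rw [integral_zero, ENNReal.ofReal_zero] at h3
  exact h3

end Asymptotics

/-! ### Weak linear ODEs on the half line. -/

section WeakDerivative

open scoped Convolution

/-- A continuous function on the half line with vanishing weak derivative is constant. -/
theorem eq_of_forall_integral_deriv_mul_eq_zero {W : ℝ → ℝ} (hW : ContinuousOn W (Ici 0))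
    (h : ∀ η : ℝ → ℝ, ContDiff ℝ ∞ η → HasCompactSupport η → tsupport η ⊆ Ioi 0 →
      ∫ t in Ioi (0 : ℝ), deriv η t * W t = 0) {t : ℝ} (ht : 0 ≤ t) : W t = W 0 := by
  -- A continuous extension to the whole line, so that it can be mollified.
  set W' : ℝ → ℝ := fun t => W (max t 0) with hW'
  have hWc : Continuous W' :=
    hW.comp_continuous (by fun_prop) fun t => le_max_right t 0
  have hWW : ∀ t, 0 ≤ t → W' t = W t := fun t ht => by simp [hW', ht]
  let φ : ℕ → ContDiffBump (0 : ℝ) := fun k =>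
    ⟨1 / ((k : ℝ) + 1) / 2, 1 / ((k : ℝ) + 1), half_pos Nat.one_div_pos_of_nat,
      half_lt_self Nat.one_div_pos_of_nat⟩
  have hφ : Tendsto (fun k => (φ k).rOut) atTop (𝓝 0) := tendsto_one_div_add_atTop_nhds_zero_nat
  let G : ℕ → ℝ → ℝ := fun k =>
    ((φ k).normed volume) ⋆[ContinuousLinearMap.lsmul ℝ ℝ, volume] W'
  have hG : ∀ x, Tendsto (fun k => G k x) atTop (𝓝 (W' x)) := fun x =>
    ContDiffBump.convolution_tendsto_right_of_continuous hφ hWc x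
  have hderiv : ∀ k x, (φ k).rOut < x → HasDerivAt (G k) 0 x := by
    intro k x hx
    have h1 := HasCompactSupport.hasDerivAt_convolution_left (ContinuousLinearMap.lsmul ℝ ℝ)
      ((φ k).hasCompactSupport_normed (μ := volume)) ((φ k).contDiff_normed (n := 1))
      (hWc.locallyIntegrable (μ := volume)) x
    have h2 : (deriv ((φ k).normed volume) ⋆[ContinuousLinearMap.lsmul ℝ ℝ, volume] W') x = 0 := by
      -- For `x > rOut` the reflected mollifier centred at `x` is supported in `(0,∞)`, hence is an
      -- admissible test function, and the derivative of the mollification vanishes.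
      set η : ℝ → ℝ := fun τ => (φ k).normed volume (x - τ) with hη
      have hsupp : tsupport η ⊆ Icc (x - (φ k).rOut) (x + (φ k).rOut) := by
        refine closure_minimal (fun τ hτ => ?_) isClosed_Icc
        have : x - τ ∈ Function.support ((φ k).normed volume) := hτ
        rw [(φ k).support_normed_eq, mem_ball_zero_iff, Real.norm_eq_abs, abs_lt] at this
        exact ⟨by linarith [this.2], by linarith [this.1]⟩
      have hpos : Icc (x - (φ k).rOut) (x + (φ k).rOut) ⊆ Ioi 0 := fun τ hτ => by
        have := hτ.1
        exact lt_of_lt_of_le (by linarith) this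
      have h3 := h η ((φ k).contDiff_normed.comp (by fun_prop))
        (isCompact_Icc.of_isClosed_subset (isClosed_tsupport η) hsupp) (hsupp.trans hpos)
      have hd : ∀ τ, deriv η τ = -deriv ((φ k).normed volume) (x - τ) := fun τ => by
        rw [hη, deriv_comp_const_sub]
      have h4 : ∫ τ in Ioi (0 : ℝ), deriv η τ * W τ = ∫ τ, deriv η τ * W' τ := by
        rw [← setIntegral_eq_integral_of_forall_compl_eq_zero (s := Ioi 0)
          (f := fun τ => deriv η τ * W' τ)]
        · refine setIntegral_congr_fun measurableSet_Ioi fun τ hτ => ?_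
          simp only [hWW τ (le_of_lt hτ)]
        · intro τ hτ
          have : τ ∉ tsupport (deriv η) := fun hmem =>
            hτ (hpos (hsupp (closure_minimal (support_deriv_subset (f := η)) (isClosed_tsupport η) hmem)))
          rw [image_eq_zero_of_notMem_tsupport this, zero_mul]
      rw [h4] at h3
      rw [convolution_eq_swap]
      simp only [hd, neg_mul, integral_neg, neg_eq_zero] at h3
      simpa using h3
    rwa [h2] at h1
  have hconst : ∀ a b, 0 < a → 0 < b → W' a = W' b := by
    intro a b ha hb
    have hev : ∀ᶠ k in atTop, G k a = G k b := by
      filter_upwards [hφ.eventually_lt_const ha, hφ.eventually_lt_const hb] with k hka hkb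
      refine IsOpen.is_const_of_deriv_eq_zero (s := Ioi (φ k).rOut) isOpen_Ioi isPreconnected_Ioi
        (fun x hx => (hderiv k x hx).differentiableAt.differentiableWithinAt)
        (fun x hx => (hderiv k x hx).deriv) hka hkb
    exact tendsto_nhds_unique ((hG a).congr' hev) (hG b)
  rcases ht.eq_or_lt with rfl | ht
  · rfl
  have h0 : Tendsto W' (𝓝[>] 0) (𝓝 (W' 0)) := hWc.continuousWithinAt
  have h1 : Tendsto W' (𝓝[>] 0) (𝓝 (W' t)) := by
    refine tendsto_const_nhds.congr' ?_
    filter_upwards [self_mem_nhdsWithin] with a ha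
    exact hconst t a ht ha
  rw [← hWW t ht.le, ← hWW 0 le_rfl]
  exact tendsto_nhds_unique h1 h0

/-- A weak solution of `w' = -m w` is an exponential. -/
theorem eq_exp_mul_of_weak_ode {w : ℝ → ℝ} {m : ℝ} (hw : ContinuousOn w (Ici 0))
    (h : ∀ θ : ℝ → ℝ, ContDiff ℝ ∞ θ → HasCompactSupport θ → tsupport θ ⊆ Ioi 0 →
      ∫ t in Ioi (0 : ℝ), (deriv θ t * w t - θ t * (m * w t)) = 0) {t : ℝ} (ht : 0 ≤ t) :
    w t = Real.exp (-(t * m)) * w 0 := by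
  have key := eq_of_forall_integral_deriv_mul_eq_zero (W := fun t => Real.exp (t * m) * w t)
    (ContinuousOn.mul (by fun_prop) hw) (fun η hη hηc hη0 => by
      -- Integrating factor: with `θ = e^{tm} η` the zeroth-order terms cancel, leaving `∫ η' e^{tm}
      -- w = 0`.
      have h1 := h (fun t => Real.exp (t * m) * η t) (by fun_prop) hηc.mul_left
        ((tsupport_mul_subset_right).trans hη0)
      refine Eq.trans ?_ h1
      refine setIntegral_congr_fun measurableSet_Ioi fun t _ => ?_
      have hd : HasDerivAt (fun t => Real.exp (t * m) * η t)
          (Real.exp (t * m) * m * η t + Real.exp (t * m) * deriv η t) t := by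
        have e1 : HasDerivAt (fun t => Real.exp (t * m)) (Real.exp (t * m) * m) t := by
          simpa using ((hasDerivAt_id t).mul_const m).exp
        exact e1.mul (hη.differentiable (by simp) t).hasDerivAt
      simp only [hd.deriv]
      ring) ht
  simp only [zero_mul, Real.exp_zero, one_mul] at key
  rw [← key, ← mul_assoc, ← Real.exp_add, neg_add_cancel, Real.exp_zero, one_mul]

end WeakDerivative

/-! ### The fractional Laplacian of slowly modulated plane waves. -/

section FractionalLaplacian

open scoped RealInnerProductSpace

/-- The Fourier symbol of the fractional Laplacian. -/
noncomputable def fracSymbol {V : Type*} [NormedAddCommGroup V] (s : ℝ) (ξ : V) : ℝ :=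
  (2 * Real.pi * ‖ξ‖) ^ (2 * s)

theorem fracSymbol_nonneg {V : Type*} [NormedAddCommGroup V] (s : ℝ) (ξ : V) :
    0 ≤ fracSymbol s ξ := by
  unfold fracSymbol
  positivity

theorem fracSymbol_neg {V : Type*} [NormedAddCommGroup V] (s : ℝ) (ξ : V) :
    fracSymbol s (-ξ) = fracSymbol s ξ := by
  simp [fracSymbol]

/-- A polynomial majorant, to be integrated against the rapidly decaying transform of a test
function. -/
theorem fracSymbol_le {V : Type*} [NormedAddCommGroup V] {s : ℝ} (hs0 : 0 < s) (hs1 : s < 1)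
    (ξ : V) {a : ℝ} (ha : ‖ξ‖ ≤ a) : fracSymbol s ξ ≤ 1 + (2 * Real.pi * a) ^ 2 := by
  have h0 : 0 ≤ 2 * Real.pi * ‖ξ‖ := by positivity
  have h1 : (2 * Real.pi * ‖ξ‖) ^ 2 ≤ (2 * Real.pi * a) ^ 2 := by gcongr
  refine le_trans ?_ (add_le_add_right h1 1)
  rcases le_total (2 * Real.pi * ‖ξ‖) 1 with h | h
  · exact (Real.rpow_le_one h0 h (by positivity)).trans (by nlinarith)
  · refine (Real.rpow_le_rpow_of_exponent_le h (by linarith : 2 * s ≤ 2)).trans ?_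
    rw [Real.rpow_two]
    linarith

theorem continuous_fracSymbol {V : Type*} [NormedAddCommGroup V] {s : ℝ} (hs0 : 0 < s) :
    Continuous (fracSymbol s : V → ℝ) :=
  continuous_two_pi_norm_rpow hs0

variable {V : Type*} [NormedAddCommGroup V] [InnerProductSpace ℝ V]

/-- The plane wave `exp (2πi⟪x, ζ⟫)`. -/
noncomputable def planeWave (ζ x : V) : ℂ :=
  Complex.exp (↑(2 * Real.pi * ⟪x, ζ⟫) * Complex.I)

theorem norm_planeWave (ζ x : V) : ‖planeWave ζ x‖ = 1 := Complex.norm_exp_ofReal_mul_I _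

theorem contDiff_planeWave (ζ : V) : ContDiff ℝ ∞ (planeWave ζ) := by
  unfold planeWave
  have h1 : ContDiff ℝ ∞ (fun x : V => ((2 * Real.pi * ⟪x, ζ⟫ : ℝ) : ℂ)) :=
    Complex.ofRealCLM.contDiff.comp
      (contDiff_const.mul (contDiff_id.inner ℝ contDiff_const))
  exact Complex.contDiff_exp.comp (h1.mul contDiff_const)

/-- A real wave packet. -/
noncomputable def wavePacket (φ : V → ℝ) (ζ : V) (α r : ℝ) (x : V) : ℝ :=
  φ (r • x) * Real.cos (2 * Real.pi * ⟪x, ζ⟫ + α)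

theorem cos_eq_planeWave (ζ : V) (α : ℝ) (x : V) :
    ((Real.cos (2 * Real.pi * ⟪x, ζ⟫ + α) : ℝ) : ℂ) =
      Complex.exp (α * Complex.I) / 2 * planeWave ζ x +
        Complex.exp (-α * Complex.I) / 2 * planeWave (-ζ) x := by
  rw [Complex.ofReal_cos, Complex.cos, planeWave, planeWave, div_mul_eq_mul_div,
    div_mul_eq_mul_div, ← Complex.exp_add, ← Complex.exp_add, ← add_div, inner_neg_right]
  push_cast
  congr 3 <;> ring

theorem contDiff_wavePacket {φ : V → ℝ} (h : ContDiff ℝ ∞ φ) (ζ : V) (α r : ℝ) :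
    ContDiff ℝ ∞ (wavePacket φ ζ α r) := by
  unfold wavePacket
  have := h.comp (by fun_prop : ContDiff ℝ ∞ fun x : V => r • x)
  exact this.mul (Real.contDiff_cos.comp
    ((contDiff_const.mul (contDiff_id.inner ℝ contDiff_const)).add contDiff_const))

theorem hasCompactSupport_wavePacket {φ : V → ℝ} (hc : HasCompactSupport φ) (ζ : V) (α : ℝ)
    {r : ℝ} (hr : 0 < r) : HasCompactSupport (wavePacket φ ζ α r) :=
  (hc.comp_smul hr.ne').mul_right

variable [FiniteDimensional ℝ V] [MeasurableSpace V] [BorelSpace V]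

theorem integrable_weight_mul_fourier {χ : V → ℂ} (h : ContDiff ℝ ∞ χ) (hc : HasCompactSupport χ)
    (b : ℝ) : Integrable (fun ξ => (1 + (2 * Real.pi * (b + ‖ξ‖)) ^ 2) * ‖𝓕 χ ξ‖) := by
  let χS : SchwartzMap V ℂ := hc.toSchwartzMap h
  have e : 𝓕 χ = (𝓕 χS : SchwartzMap V ℂ) := (SchwartzMap.fourier_coe χS).symm
  rw [e]
  have h0 := (SchwartzMap.integrable_pow_mul volume (𝓕 χS : SchwartzMap V ℂ) 0)
  have h1 := (SchwartzMap.integrable_pow_mul volume (𝓕 χS : SchwartzMap V ℂ) 1)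
  have h2 := (SchwartzMap.integrable_pow_mul volume (𝓕 χS : SchwartzMap V ℂ) 2)
  have h3 := ((h0.const_mul (1 + (2 * Real.pi * b) ^ 2)).add
    (h1.const_mul (2 * (2 * Real.pi) ^ 2 * b))).add (h2.const_mul ((2 * Real.pi) ^ 2))
  refine h3.congr (Eventually.of_forall fun ξ => ?_)
  simp only [Pi.add_apply]
  ring

theorem integrable_fracSymbol_mul_fourier {s : ℝ} (hs0 : 0 < s) (hs1 : s < 1) {χ : V → ℂ}
    (h : ContDiff ℝ ∞ χ) (hc : HasCompactSupport χ) :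
    Integrable (fun ξ => (fracSymbol s ξ : ℂ) * 𝓕 χ ξ) := by
  refine (integrable_weight_mul_fourier h hc 0).mono' ?_ (Eventually.of_forall fun ξ => ?_)
  · have h1 := continuous_fracSymbol (V := V) hs0
    have h2 := continuous_fourier (h.continuous.integrable_of_hasCompactSupport hc)
    exact Continuous.aestronglyMeasurable (by fun_prop)
  · rw [norm_mul, Complex.norm_real, Real.norm_of_nonneg (fracSymbol_nonneg s ξ)]
    gcongr
    exact fracSymbol_le hs0 hs1 ξ (by simp)

theorem fourier_dilation_mul_planeWave (φ : V → ℂ) {r : ℝ} (hr : 0 < r) (ζ ξ : V) :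
    𝓕 (fun x => φ (r • x) * planeWave ζ x) ξ =
      ((r ^ Module.finrank ℝ V)⁻¹ : ℝ) * 𝓕 φ (r⁻¹ • (ξ - ζ)) := by
  have h := Measure.integral_comp_smul_of_nonneg (volume : Measure V)
    (fun y => Complex.exp (↑(-2 * Real.pi * ⟪y, r⁻¹ • (ξ - ζ)⟫) * Complex.I) • φ y) r
      (hR := hr.le)
  rw [Real.fourier_eq', Real.fourier_eq', ← Complex.real_smul, ← h]
  congr 1; ext x
  simp only [planeWave, smul_eq_mul]
  rw [mul_left_comm, ← Complex.exp_add, mul_comm]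
  congr 2
  rw [real_inner_smul_left, real_inner_smul_right, mul_inv_cancel_left₀ hr.ne', inner_sub_right]
  push_cast
  ring

/-- The fractional Laplacian of a wave packet, in rescaled frequency variables. -/
noncomputable def wavePacketLaplacian (s : ℝ) (φ : V → ℂ) (r : ℝ) (ζ x : V) : ℂ :=
  ∫ η, planeWave (ζ + r • η) x * ((fracSymbol s (ζ + r • η) : ℂ) * 𝓕 φ η)

/-- Dilation by `r` concentrates the transform near `ζ` at scale `r`; the substitution `ξ = ζ + r η`
moves the dependence on `r` from the profile into the symbol and the wave. -/
theorem fourierInv_fracSymbol_mul_fourier_wavePacket (s : ℝ) (φ : V → ℂ) {r : ℝ} (hr : 0 < r)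
    (ζ x : V) :
    𝓕⁻ (fun ξ => (fracSymbol s ξ : ℂ) * 𝓕 (fun x => φ (r • x) * planeWave ζ x) ξ) x =
      wavePacketLaplacian s φ r ζ x := by
  set F : V → ℂ := fun ξ => planeWave ξ x * ((fracSymbol s ξ : ℂ) *
    (((r ^ Module.finrank ℝ V)⁻¹ : ℝ) * 𝓕 φ (r⁻¹ • (ξ - ζ)))) with hF
  have h1 : 𝓕⁻ (fun ξ => (fracSymbol s ξ : ℂ) * 𝓕 (fun x => φ (r • x) * planeWave ζ x) ξ) x =
      ∫ ξ, F ξ := by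
    rw [Real.fourierInv_eq']
    congr 1; ext ξ
    rw [fourier_dilation_mul_planeWave φ hr, hF, smul_eq_mul]
    simp only [planeWave, real_inner_comm]
  have h2 := Measure.integral_comp_smul_of_nonneg (volume : Measure V)
    (fun ξ => F (ζ + ξ)) r (hR := hr.le)
  rw [integral_add_left_eq_self F ζ] at h2
  have hrn : (r ^ Module.finrank ℝ V : ℝ) ≠ 0 := by positivity
  have h3 : ∫ ξ, F ξ = (r ^ Module.finrank ℝ V : ℝ) • ∫ η, F (ζ + r • η) := by
    rw [h2, smul_smul, mul_inv_cancel₀ hrn, one_smul]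
  rw [h1, h3, wavePacketLaplacian, ← integral_smul]
  congr 1; ext η
  simp only [hF, add_sub_cancel_left, inv_smul_smul₀ hr.ne', Complex.real_smul]
  have : ((r ^ Module.finrank ℝ V : ℝ) : ℂ) * (((r ^ Module.finrank ℝ V)⁻¹ : ℝ) : ℂ) = 1 := by
    rw [← Complex.ofReal_mul, mul_inv_cancel₀ hrn, Complex.ofReal_one]
  linear_combination (planeWave (ζ + r • η) x * ((fracSymbol s (ζ + r • η) : ℂ) * 𝓕 φ η)) * this

theorem norm_wavePacket_integrand_le {s : ℝ} (hs0 : 0 < s) (hs1 : s < 1) (φ : V → ℂ) {r : ℝ}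
    (hr : 0 ≤ r) (hr1 : r ≤ 1) (ζ x η : V) :
    ‖planeWave (ζ + r • η) x * ((fracSymbol s (ζ + r • η) : ℂ) * 𝓕 φ η)‖ ≤
      (1 + (2 * Real.pi * (‖ζ‖ + ‖η‖)) ^ 2) * ‖𝓕 φ η‖ := by
  rw [norm_mul, norm_mul, norm_planeWave, one_mul, Complex.norm_real,
    Real.norm_of_nonneg (fracSymbol_nonneg _ _)]
  gcongr
  refine fracSymbol_le hs0 hs1 _ ((norm_add_le _ _).trans (add_le_add_right ?_ _))
  rw [norm_smul, Real.norm_of_nonneg hr]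
  exact mul_le_of_le_one_left (norm_nonneg _) hr1

theorem norm_wavePacketLaplacian_le {s : ℝ} (hs0 : 0 < s) (hs1 : s < 1) {φ : V → ℂ}
    (h : ContDiff ℝ ∞ φ) (hc : HasCompactSupport φ) {r : ℝ} (hr : 0 ≤ r) (hr1 : r ≤ 1) (ζ x : V) :
    ‖wavePacketLaplacian s φ r ζ x‖ ≤
      ∫ η, (1 + (2 * Real.pi * (‖ζ‖ + ‖η‖)) ^ 2) * ‖𝓕 φ η‖ :=
  norm_integral_le_of_norm_le (integrable_weight_mul_fourier h hc _)
    (Eventually.of_forall fun η => norm_wavePacket_integrand_le hs0 hs1 φ hr hr1 ζ x η)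

/-- The symbol at `ζ + r η` tends to the symbol at `ζ`, and the remaining integral of `𝓕 φ` is `φ 0`
by inversion. -/
theorem tendsto_wavePacketLaplacian {s : ℝ} (hs0 : 0 < s) (hs1 : s < 1) {φ : V → ℂ}
    (h : ContDiff ℝ ∞ φ) (hc : HasCompactSupport φ) (ζ x : V) :
    Tendsto (fun r => wavePacketLaplacian s φ r ζ x) (𝓝[>] 0)
      (𝓝 (planeWave ζ x * ((fracSymbol s ζ : ℂ) * φ 0))) := by
  have hφi := h.continuous.integrable_of_hasCompactSupport (μ := volume) hc
  have hFc := continuous_fourier hφi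
  have hm := continuous_fracSymbol (V := V) hs0
  have hpw : Continuous (fun ζ => planeWave ζ x) := by unfold planeWave; fun_prop
  have h0 : ∫ η, 𝓕 φ η = φ 0 := by
    have h1 : 𝓕⁻ (𝓕 φ) = φ := by
      let χS : SchwartzMap V ℂ := hc.toSchwartzMap h
      refine Continuous.fourierInv_fourier_eq h.continuous hφi ?_
      have e : 𝓕 φ = (𝓕 χS : SchwartzMap V ℂ) := (SchwartzMap.fourier_coe χS).symm
      rw [e]
      exact SchwartzMap.integrable _
    have h2 := congrFun h1 0
    rw [Real.fourierInv_eq'] at h2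
    simpa using h2
  have hlim : Tendsto (fun r => wavePacketLaplacian s φ r ζ x) (𝓝[>] 0)
      (𝓝 (∫ η, planeWave (ζ + (0 : ℝ) • η) x *
        ((fracSymbol s (ζ + (0 : ℝ) • η) : ℂ) * 𝓕 φ η))) := by
    refine tendsto_integral_filter_of_dominated_convergence _ ?_ ?_
      (integrable_weight_mul_fourier h hc ‖ζ‖) (Eventually.of_forall fun η => ?_)
    · refine Eventually.of_forall fun r => Continuous.aestronglyMeasurable ?_
      exact (hpw.comp (by fun_prop)).mul
        ((Complex.continuous_ofReal.comp (hm.comp (by fun_prop))).mul hFc)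
    · filter_upwards [Ioc_mem_nhdsGT one_pos] with r hr
      exact Eventually.of_forall fun η =>
        norm_wavePacket_integrand_le hs0 hs1 φ hr.1.le hr.2 ζ x η
    · have hcr : Continuous (fun r : ℝ => planeWave (ζ + r • η) x *
          ((fracSymbol s (ζ + r • η) : ℂ) * 𝓕 φ η)) :=
        (hpw.comp (by fun_prop)).mul
          ((Complex.continuous_ofReal.comp (hm.comp (by fun_prop))).mul continuous_const)
      exact (hcr.tendsto 0).mono_left nhdsWithin_le_nhds
  simp only [zero_smul, add_zero] at hlim
  rwa [integral_const_mul, integral_const_mul, h0] at hlim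

end FractionalLaplacian

namespace FracHeat

open scoped RealInnerProductSpace

variable {n : ℕ} {s : ℝ}

local notation "𝔼" => EuclideanSpace ℝ (Fin n)

theorem fracLaplacian_const_mul (c : ℝ) (φ : 𝔼 → ℝ) (x : 𝔼) :
    fracLaplacian s (fun y => c * φ y) x = c * fracLaplacian s φ x := by
  have h1 : ∀ ξ, 𝓕 (fun y => ((c * φ y : ℝ) : ℂ)) ξ = (c : ℂ) * 𝓕 (fun y => (φ y : ℂ)) ξ := by
    intro ξ
    rw [Real.fourier_eq', Real.fourier_eq', ← integral_const_mul]
    congr 1; ext y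
    simp only [smul_eq_mul, Complex.ofReal_mul]
    ring
  rw [fracLaplacian, fracLaplacian, ← Complex.re_ofReal_mul]
  congr 1
  rw [Real.fourierInv_eq', Real.fourierInv_eq', ← integral_const_mul]
  congr 1; ext ξ
  rw [h1, smul_eq_mul, smul_eq_mul]
  ring

theorem continuous_fracLaplacian (hs0 : 0 < s) (hs1 : s < 1) {φ : 𝔼 → ℝ} (h : ContDiff ℝ ∞ φ)
    (hc : HasCompactSupport φ) : Continuous (fracLaplacian s φ) :=
  Complex.continuous_re.comp (continuous_fourierInv (integrable_fracSymbol_mul_fourier hs0 hs1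
    (Complex.ofRealCLM.contDiff.comp h) (hc.comp_left Complex.ofReal_zero)))

theorem fracLaplacian_wavePacket (hs0 : 0 < s) (hs1 : s < 1) {φ : 𝔼 → ℝ} (h : ContDiff ℝ ∞ φ)
    (hc : HasCompactSupport φ) (ζ : 𝔼) (α : ℝ) {r : ℝ} (hr : 0 < r) (x : 𝔼) :
    fracLaplacian s (wavePacket φ ζ α r) x =
      (Complex.exp (α * Complex.I) / 2 * wavePacketLaplacian s (fun y => (φ y : ℂ)) r ζ x +
        Complex.exp (-α * Complex.I) / 2 *
          wavePacketLaplacian s (fun y => (φ y : ℂ)) r (-ζ) x).re := by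
  set φc : 𝔼 → ℂ := fun y => (φ y : ℂ) with hφc
  have hφd : ContDiff ℝ ∞ φc := Complex.ofRealCLM.contDiff.comp h
  have hφs : HasCompactSupport φc := hc.comp_left Complex.ofReal_zero
  set χ : 𝔼 → 𝔼 → ℂ := fun ζ x => φc (r • x) * planeWave ζ x with hχ
  have hχd : ∀ ζ, ContDiff ℝ ∞ (χ ζ) := fun ζ =>
    (hφd.comp (by fun_prop : ContDiff ℝ ∞ fun x : 𝔼 => r • x)).mul (contDiff_planeWave ζ)
  have hχs : ∀ ζ, HasCompactSupport (χ ζ) := fun ζ => (hφs.comp_smul hr.ne').mul_right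
  have hχi : ∀ ζ, Integrable (χ ζ) := fun ζ =>
    (hχd ζ).continuous.integrable_of_hasCompactSupport (hχs ζ)
  have hconv : ∀ {f : 𝔼 → ℂ}, Integrable f → ∀ ξ,
      Integrable (fun v => Real.fourierChar (-⟪v, ξ⟫) • f v) :=
    fun hf ξ => (Real.fourierIntegral_convergent_iff ξ).2 hf
  set a := Complex.exp (α * Complex.I) / 2
  set b := Complex.exp (-α * Complex.I) / 2
  have h1 : (fun y => (wavePacket φ ζ α r y : ℂ)) = fun y => a * χ ζ y + b * χ (-ζ) y := by
    ext y
    simp only [wavePacket, hχ, hφc, Complex.ofReal_mul, cos_eq_planeWave]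
    ring
  have h2 : ∀ ξ, 𝓕 (fun y => (wavePacket φ ζ α r y : ℂ)) ξ =
      a * 𝓕 (χ ζ) ξ + b * 𝓕 (χ (-ζ)) ξ := by
    intro ξ
    rw [h1, Real.fourier_eq, Real.fourier_eq, Real.fourier_eq, ← integral_const_mul,
      ← integral_const_mul, ← integral_add ((hconv (hχi ζ) ξ).const_mul a)
        ((hconv (hχi (-ζ)) ξ).const_mul b)]
    congr 1; ext y
    simp only [smul_add, mul_smul_comm]
  rw [fracLaplacian]
  congr 1
  rw [← fourierInv_fracSymbol_mul_fourier_wavePacket s φc hr,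
    ← fourierInv_fracSymbol_mul_fourier_wavePacket s φc hr]
  have hi : ∀ ζ, Integrable (fun ξ => Complex.exp (↑(2 * Real.pi * ⟪ξ, x⟫) * Complex.I) •
      ((fracSymbol s ξ : ℂ) * 𝓕 (χ ζ) ξ)) := fun ζ => by
    refine (integrable_fracSymbol_mul_fourier hs0 hs1 (hχd ζ) (hχs ζ)).bdd_mul (c := 1)
      (Continuous.aestronglyMeasurable (by fun_prop)) (Eventually.of_forall fun ξ => ?_)
    rw [Complex.norm_exp_ofReal_mul_I]
  rw [Real.fourierInv_eq', Real.fourierInv_eq', Real.fourierInv_eq', ← integral_const_mul,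
    ← integral_const_mul, ← integral_add ((hi ζ).const_mul a) ((hi (-ζ)).const_mul b)]
  congr 1; ext ξ
  rw [h2]
  simp only [smul_eq_mul, fracSymbol]
  ring

/-- Uniformity in both `r ≤ 1` and `x` is what permits dominated convergence against a merely
integrable `u(t)`. -/
theorem exists_abs_fracLaplacian_wavePacket_le (hs0 : 0 < s) (hs1 : s < 1) {φ : 𝔼 → ℝ}
    (h : ContDiff ℝ ∞ φ) (hc : HasCompactSupport φ) (ζ : 𝔼) (α : ℝ) :
    ∃ C, ∀ r : ℝ, 0 < r → r ≤ 1 → ∀ x, |fracLaplacian s (wavePacket φ ζ α r) x| ≤ C := by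
  have hφd : ContDiff ℝ ∞ (fun y => (φ y : ℂ)) := Complex.ofRealCLM.contDiff.comp h
  have hφs : HasCompactSupport (fun y => (φ y : ℂ)) := hc.comp_left Complex.ofReal_zero
  refine ⟨∫ η, (1 + (2 * Real.pi * (‖ζ‖ + ‖η‖)) ^ 2) * ‖𝓕 (fun y => (φ y : ℂ)) η‖,
    fun r hr hr1 x => ?_⟩
  rw [fracLaplacian_wavePacket hs0 hs1 h hc ζ α hr]
  refine (Complex.abs_re_le_norm _).trans ((norm_add_le _ _).trans ?_)
  have h1 := norm_wavePacketLaplacian_le hs0 hs1 hφd hφs hr.le hr1 ζ x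
  have h2 := norm_wavePacketLaplacian_le hs0 hs1 hφd hφs hr.le hr1 (-ζ) x
  rw [norm_neg] at h2
  have e1 : ‖Complex.exp (-(α : ℂ) * Complex.I)‖ = 1 := by
    rw [← Complex.ofReal_neg, Complex.norm_exp_ofReal_mul_I]
  rw [norm_mul, norm_mul, norm_div, norm_div, Complex.norm_exp_ofReal_mul_I, e1,
    Complex.norm_ofNat]
  linarith

theorem tendsto_fracLaplacian_wavePacket (hs0 : 0 < s) (hs1 : s < 1) {φ : 𝔼 → ℝ}
    (h : ContDiff ℝ ∞ φ) (hc : HasCompactSupport φ) (ζ : 𝔼) (α : ℝ) (x : 𝔼) :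
    Tendsto (fun r => fracLaplacian s (wavePacket φ ζ α r) x) (𝓝[>] 0)
      (𝓝 (fracSymbol s ζ * φ 0 * Real.cos (2 * Real.pi * ⟪x, ζ⟫ + α))) := by
  have hφd : ContDiff ℝ ∞ (fun y => (φ y : ℂ)) := Complex.ofRealCLM.contDiff.comp h
  have hφs : HasCompactSupport (fun y => (φ y : ℂ)) := hc.comp_left Complex.ofReal_zero
  have h1 := (tendsto_wavePacketLaplacian hs0 hs1 hφd hφs ζ x).const_mul
    (Complex.exp (α * Complex.I) / 2)
  have h2 := (tendsto_wavePacketLaplacian hs0 hs1 hφd hφs (-ζ) x).const_mul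
    (Complex.exp (-α * Complex.I) / 2)
  have h3 := (Complex.continuous_re.tendsto _).comp (h1.add h2)
  have e : Complex.exp (α * Complex.I) / 2 * (planeWave ζ x * (fracSymbol s ζ * φ 0)) +
      Complex.exp (-α * Complex.I) / 2 * (planeWave (-ζ) x * (fracSymbol s (-ζ) * φ 0)) =
      ((fracSymbol s ζ * φ 0 * Real.cos (2 * Real.pi * ⟪x, ζ⟫ + α) : ℝ) : ℂ) := by
    rw [Complex.ofReal_mul, cos_eq_planeWave, fracSymbol_neg]
    push_cast
    ring
  rw [e, Complex.ofReal_re] at h3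
  refine h3.congr' ?_
  filter_upwards [self_mem_nhdsWithin] with r hr
  exact (fracLaplacian_wavePacket hs0 hs1 h hc ζ α hr x).symm

end FracHeat

/-! ### Pairing `L¹` functions with bounded functions. -/

section Pairing

variable {α : Type*} [MeasurableSpace α] {μ : Measure α}

theorem integrable_coeFn_mul_of_bounded (f : Lp ℝ 1 μ) {b : α → ℝ}
    (hb : AEStronglyMeasurable b μ) {C : ℝ} (hC : ∀ x, |b x| ≤ C) :
    Integrable (fun x => f x * b x) μ :=
  (L1.integrable_coeFn f).mul_bdd hb (Eventually.of_forall hC)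

theorem norm_integral_coeFn_mul_le (f : Lp ℝ 1 μ) {b : α → ℝ} {C : ℝ} (hC : ∀ x, |b x| ≤ C) :
    ‖∫ x, f x * b x ∂μ‖ ≤ C * ‖f‖ := by
  rw [L1.norm_eq_integral_norm, ← integral_const_mul]
  refine norm_integral_le_of_norm_le ((L1.integrable_coeFn f).norm.const_mul C)
    (Eventually.of_forall fun x => ?_)
  rw [norm_mul, mul_comm]
  exact mul_le_mul_of_nonneg_right (hC x) (norm_nonneg _)

theorem continuous_integral_coeFn_mul {b : α → ℝ} (hb : AEStronglyMeasurable b μ) {C : ℝ}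
    (hC : ∀ x, |b x| ≤ C) : Continuous (fun f : Lp ℝ 1 μ => ∫ x, f x * b x ∂μ) := by
  refine (LipschitzWith.of_dist_le_mul (K := C.toNNReal) fun f g => ?_).continuous
  have h1 : (∫ x, f x * b x ∂μ) - ∫ x, g x * b x ∂μ = ∫ x, (f - g : Lp ℝ 1 μ) x * b x ∂μ := by
    rw [← integral_sub (integrable_coeFn_mul_of_bounded f hb hC)
      (integrable_coeFn_mul_of_bounded g hb hC)]
    refine integral_congr_ae ?_
    filter_upwards [Lp.coeFn_sub f g] with x hx
    rw [hx, Pi.sub_apply, sub_mul]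
  rw [dist_eq_norm, dist_eq_norm, h1]
  refine (norm_integral_coeFn_mul_le _ hC).trans ?_
  gcongr
  exact Real.le_coe_toNNReal C

end Pairing

/-! ### The Fourier transform of a weak solution. -/

namespace FracHeat

open scoped RealInnerProductSpace

variable {n : ℕ} {s : ℝ}

local notation "𝔼" => EuclideanSpace ℝ (Fin n)

theorem IsWeakSolution.weak_eq_mul {u₀ : 𝔼 → ℝ} {u : ℝ → Lp ℝ 1 (volume : Measure 𝔼)}
    (hu : IsWeakSolution s u₀ u) {θ : ℝ → ℝ} (hθ : ContDiff ℝ ∞ θ) (hθc : HasCompactSupport θ)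
    (hθ0 : tsupport θ ⊆ Ioi 0) {g : 𝔼 → ℝ} (hg : ContDiff ℝ ∞ g) (hgc : HasCompactSupport g) :
    ∫ t in Ioi (0 : ℝ), ∫ x, u t x * (deriv θ t * g x - θ t * fracLaplacian s g x) = 0 := by
  have hsub : tsupport (fun p : ℝ × 𝔼 => θ p.1 * g p.2) ⊆ tsupport θ ×ˢ tsupport g := by
    refine closure_minimal (fun p hp => ?_) ((isClosed_tsupport θ).prod (isClosed_tsupport g))
    exact ⟨subset_tsupport _ (left_ne_zero_of_mul hp), subset_tsupport _ (right_ne_zero_of_mul hp)⟩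
  have h := hu.weak_eq (fun p => θ p.1 * g p.2)
    ((hθ.comp contDiff_fst).mul (hg.comp contDiff_snd))
    ((hθc.isCompact.prod hgc.isCompact).of_isClosed_subset (isClosed_tsupport _) hsub)
    (hsub.trans (prod_mono hθ0 (subset_univ _)))
  simpa only [fracLaplacian_const_mul, deriv_mul_const_field] using h

/-- The cosine transforms of a weak solution satisfy, weakly, the equation `w' = -|ξ|^{2s} w`. -/
theorem IsWeakSolution.integral_cos_weak_ode (hs0 : 0 < s) (hs1 : s < 1) {u₀ : 𝔼 → ℝ}
    {u : ℝ → Lp ℝ 1 (volume : Measure 𝔼)} (hu : IsWeakSolution s u₀ u) (ζ : 𝔼) (α : ℝ)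
    {θ : ℝ → ℝ} (hθ : ContDiff ℝ ∞ θ) (hθc : HasCompactSupport θ) (hθ0 : tsupport θ ⊆ Ioi 0) :
    ∫ t in Ioi (0 : ℝ), (deriv θ t * (∫ x, u t x * Real.cos (2 * Real.pi * ⟪x, ζ⟫ + α)) -
      θ t * (fracSymbol s ζ * ∫ x, u t x * Real.cos (2 * Real.pi * ⟪x, ζ⟫ + α))) = 0 := by
  -- A cutoff with `φ 0 = 1`, so that the packets tend to the cosine itself as the scale goes to
  -- `0`.
  let φ : ContDiffBump (0 : 𝔼) := ⟨1, 2, one_pos, one_lt_two⟩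
  have hφ : ContDiff ℝ ∞ φ := φ.contDiff
  have hφc : HasCompactSupport φ := φ.hasCompactSupport
  have hφ0 : φ 0 = 1 := φ.one_of_mem_closedBall (by simp [φ])
  obtain ⟨C, hC⟩ := exists_abs_fracLaplacian_wavePacket_le hs0 hs1 hφ hφc ζ α
  set r : ℕ → ℝ := fun k => 1 / ((k : ℝ) + 1) with hr
  have hr0 : ∀ k, 0 < r k := fun k => Nat.one_div_pos_of_nat
  have hr1 : ∀ k, r k ≤ 1 := fun k => by
    rw [hr]; simp only; rw [div_le_one (by positivity)]; simp
  have hrlim : Tendsto r atTop (𝓝[>] 0) :=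
    tendsto_nhdsWithin_iff.2 ⟨tendsto_one_div_add_atTop_nhds_zero_nat, Eventually.of_forall hr0⟩
  set g : ℕ → 𝔼 → ℝ := fun k => wavePacket φ ζ α (r k) with hg
  have hgd : ∀ k, ContDiff ℝ ∞ (g k) := fun k => contDiff_wavePacket hφ ζ α _
  have hgc : ∀ k, HasCompactSupport (g k) := fun k => hasCompactSupport_wavePacket hφc ζ α (hr0 k)
  have hg1 : ∀ k x, |g k x| ≤ 1 := fun k x => by
    rw [hg]
    simp only [wavePacket]
    rw [abs_mul, abs_of_nonneg φ.nonneg]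
    exact mul_le_one₀ φ.le_one (abs_nonneg _) (Real.abs_cos_le_one _)
  have hgm : ∀ k, AEStronglyMeasurable (g k) volume := fun k =>
    (hgd k).continuous.aestronglyMeasurable
  have hLm : ∀ k, AEStronglyMeasurable (fracLaplacian s (g k)) volume := fun k =>
    (continuous_fracLaplacian hs0 hs1 (hgd k) (hgc k)).aestronglyMeasurable
  have hL1 : ∀ k x, |fracLaplacian s (g k) x| ≤ C := fun k x => hC _ (hr0 k) (hr1 k) x
  have hglim : ∀ x, Tendsto (fun k => g k x) atTop (𝓝 (Real.cos (2 * Real.pi * ⟪x, ζ⟫ + α))) := by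
    intro x
    have h1 : Tendsto (fun k => φ (r k • x)) atTop (𝓝 (φ ((0 : ℝ) • x))) :=
      (Continuous.tendsto (f := fun a : ℝ => φ (a • x))
        (hφ.continuous.comp (by fun_prop)) 0).comp (hrlim.mono_right nhdsWithin_le_nhds)
    rw [zero_smul, hφ0] at h1
    have h2 := h1.mul_const (Real.cos (2 * Real.pi * ⟪x, ζ⟫ + α))
    rw [one_mul] at h2
    exact h2
  have hLlim : ∀ x, Tendsto (fun k => fracLaplacian s (g k) x) atTop
      (𝓝 (fracSymbol s ζ * Real.cos (2 * Real.pi * ⟪x, ζ⟫ + α))) := by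
    intro x
    have h1 := (tendsto_fracLaplacian_wavePacket hs0 hs1 hφ hφc ζ α x).comp hrlim
    rw [hφ0, mul_one] at h1
    exact h1
  have hpair : ∀ {b : ℕ → 𝔼 → ℝ} {b' : 𝔼 → ℝ} {B : ℝ}, (∀ k, AEStronglyMeasurable (b k) volume) →
      (∀ k x, |b k x| ≤ B) → (∀ x, Tendsto (fun k => b k x) atTop (𝓝 (b' x))) → ∀ t,
      Tendsto (fun k => ∫ x, u t x * b k x) atTop (𝓝 (∫ x, u t x * b' x)) := by
    intro b b' B hm hB hlim t
    refine tendsto_integral_of_dominated_convergence (fun x => ‖u t x‖ * B)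
      (fun k => (integrable_coeFn_mul_of_bounded (u t) (hm k) (hB k)).aestronglyMeasurable)
      ((L1.integrable_coeFn (u t)).norm.mul_const B) (fun k => Eventually.of_forall fun x => ?_)
      (Eventually.of_forall fun x => (hlim x).const_mul _)
    rw [norm_mul]
    exact mul_le_mul_of_nonneg_left (hB k x) (norm_nonneg _)
  have hdc : Continuous (deriv θ) := hθ.continuous_deriv (by simp)
  have hweak : ∀ k, ∫ t in Ioi (0 : ℝ), (deriv θ t * (∫ x, u t x * g k x) -
      θ t * ∫ x, u t x * fracLaplacian s (g k) x) = 0 := by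
    intro k
    refine Eq.trans ?_ (hu.weak_eq_mul hθ hθc hθ0 (hgd k) (hgc k))
    refine setIntegral_congr_fun measurableSet_Ioi fun t _ => ?_
    rw [← integral_const_mul, ← integral_const_mul, ← integral_sub
      ((integrable_coeFn_mul_of_bounded (u t) (hgm k) (hg1 k)).const_mul _)
      ((integrable_coeFn_mul_of_bounded (u t) (hLm k) (hL1 k)).const_mul _)]
    congr 1; ext x
    ring
  have hcont : ContinuousOn u (Ioi 0) := hu.continuousOn.mono Ioi_subset_Ici_self
  have hlim : Tendsto (fun k => ∫ t in Ioi (0 : ℝ), (deriv θ t * (∫ x, u t x * g k x) -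
      θ t * ∫ x, u t x * fracLaplacian s (g k) x)) atTop
      (𝓝 (∫ t in Ioi (0 : ℝ), (deriv θ t * (∫ x, u t x * Real.cos (2 * Real.pi * ⟪x, ζ⟫ + α)) -
        θ t * ∫ x, u t x * (fracSymbol s ζ * Real.cos (2 * Real.pi * ⟪x, ζ⟫ + α))))) := by
    refine tendsto_integral_of_dominated_convergence
      (fun t => |deriv θ t| * (1 * ‖u t‖) + |θ t| * (C * ‖u t‖)) (fun k => ?_) ?_
      (fun k => Eventually.of_forall fun t => ?_) (Eventually.of_forall fun t => ?_)
    · refine ContinuousOn.aestronglyMeasurable ?_ measurableSet_Ioi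
      exact (hdc.continuousOn.mul
        ((continuous_integral_coeFn_mul (hgm k) (hg1 k)).comp_continuousOn hcont)).sub
        (hθ.continuous.continuousOn.mul
          ((continuous_integral_coeFn_mul (hLm k) (hL1 k)).comp_continuousOn hcont))
    -- No bound on `‖u t‖` for all times is needed: the majorant is continuous on `(0,∞)` and
    -- vanishes off the compact support of `θ`.
    · have hc : ContinuousOn (fun t => |deriv θ t| * (1 * ‖u t‖) + |θ t| * (C * ‖u t‖)) (Ioi 0) :=
        (hdc.abs.continuousOn.mul (continuousOn_const.mul hcont.norm)).add
          (hθ.continuous.abs.continuousOn.mul (continuousOn_const.mul hcont.norm))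
      have hK : IntegrableOn (fun t => |deriv θ t| * (1 * ‖u t‖) + |θ t| * (C * ‖u t‖))
          (tsupport θ) := (hc.mono hθ0).integrableOn_compact hθc.isCompact
      refine Integrable.integrableOn ((integrableOn_iff_integrable_of_support_subset ?_).1 hK)
      intro t ht
      by_contra hmem
      have h1 : θ t = 0 := image_eq_zero_of_notMem_tsupport hmem
      have h2 : deriv θ t = 0 := by
        by_contra h3
        exact hmem (support_deriv_subset h3)
      simp [h1, h2] at ht
    · refine (norm_sub_le _ _).trans ?_
      rw [norm_mul, norm_mul, Real.norm_eq_abs (deriv θ t), Real.norm_eq_abs (θ t)]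
      gcongr
      · exact norm_integral_coeFn_mul_le (u t) (hg1 k)
      · exact norm_integral_coeFn_mul_le (u t) (hL1 k)
    · exact ((hpair hgm hg1 hglim t).const_mul _).sub ((hpair hLm hL1 hLlim t).const_mul _)
  simp only [hweak] at hlim
  have h0 := tendsto_nhds_unique hlim tendsto_const_nhds
  refine Eq.trans ?_ h0
  refine setIntegral_congr_fun measurableSet_Ioi fun t _ => ?_
  rw [← integral_const_mul (fracSymbol s ζ)]
  congr 3; ext x
  ring

theorem IsWeakSolution.fourier_eq (hs0 : 0 < s) (hs1 : s < 1) {u₀ : 𝔼 → ℝ}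
    {u : ℝ → Lp ℝ 1 (volume : Measure 𝔼)} (hu : IsWeakSolution s u₀ u) {t : ℝ} (ht : 0 ≤ t)
    (ξ : 𝔼) :
    𝓕 (fun x => (u t x : ℂ)) ξ = heatMultiplier s t ξ * 𝓕 (fun x => (u₀ x : ℂ)) ξ := by
  have hcm : ∀ α : ℝ, AEStronglyMeasurable
      (fun x : 𝔼 => Real.cos (2 * Real.pi * ⟪x, ξ⟫ + α)) volume := fun α =>
    Continuous.aestronglyMeasurable (by fun_prop)
  have hcb : ∀ (α : ℝ) (x : 𝔼), |Real.cos (2 * Real.pi * ⟪x, ξ⟫ + α)| ≤ 1 := fun α x =>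
    Real.abs_cos_le_one _
  have hw : ∀ α : ℝ, ∫ x, u t x * Real.cos (2 * Real.pi * ⟪x, ξ⟫ + α) =
      heatMultiplier s t ξ * ∫ x, u 0 x * Real.cos (2 * Real.pi * ⟪x, ξ⟫ + α) := fun α =>
    eq_exp_mul_of_weak_ode
      ((continuous_integral_coeFn_mul (hcm α) (hcb α)).comp_continuousOn hu.continuousOn)
      (fun θ hθ hθc hθ0 => hu.integral_cos_weak_ode hs0 hs1 ξ α hθ hθc hθ0) ht
  -- Since `cos(a + π/2) = -sin a`, the phases `0` and `π/2` recover the real and imaginary parts of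
  -- `e^{-ia}`.
  have hF : ∀ f : Lp ℝ 1 (volume : Measure 𝔼), 𝓕 (fun x => (f x : ℂ)) ξ =
      ((∫ x, f x * Real.cos (2 * Real.pi * ⟪x, ξ⟫ + 0) : ℝ) : ℂ) +
        ((∫ x, f x * Real.cos (2 * Real.pi * ⟪x, ξ⟫ + Real.pi / 2) : ℝ) : ℂ) * Complex.I := by
    intro f
    have h1 := fun α => (integrable_coeFn_mul_of_bounded f (hcm α) (hcb α)).complex_ofReal
    rw [← integral_complex_ofReal, ← integral_complex_ofReal, ← integral_mul_const,
      ← integral_add (h1 _) ((h1 _).mul_const _), Real.fourier_eq']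
    congr 1; ext x
    rw [smul_eq_mul, Complex.exp_mul_I, Real.cos_add_pi_div_two, add_zero, ← Complex.ofReal_cos,
      ← Complex.ofReal_sin, neg_mul, neg_mul, Real.cos_neg, Real.sin_neg]
    push_cast
    ring
  have h0 : 𝓕 (fun x => (u₀ x : ℂ)) ξ = 𝓕 (fun x => (u 0 x : ℂ)) ξ := by
    refine Real.fourier_congr_ae ?_ ξ
    filter_upwards [hu.initial] with x hx
    rw [hx]
  rw [h0, hF, hF, hw, hw]
  push_cast
  ring

theorem heatKernel_eq_stableKernel (hn : 1 ≤ n) (hs0 : 0 < s) {t : ℝ} (ht : 0 < t) (x : 𝔼) :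
    heatKernel s t x = stableKernel s t x := by
  have : Nonempty (Fin n) := ⟨⟨0, hn⟩⟩
  exact (congrArg Complex.re (congrFun (fourierInv_heatMultiplier (V := 𝔼) hs0 ht) x)).trans
    (Complex.ofReal_re _)

end FracHeat

/-! ### Convergence to the fundamental solution. -/

theorem theorem1 (n : ℕ) (hn : 1 ≤ n) (s : ℝ) (hs0 : 0 < s) (hs1 : s < 1)
    (u₀ : EuclideanSpace ℝ (Fin n) → ℝ) (hu₀ : Integrable u₀ volume)
    (M : ℝ) (hM : ∫ x, u₀ x = M)
    (u : ℝ → Lp ℝ 1 (volume : Measure (EuclideanSpace ℝ (Fin n))))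
    (hu : FracHeat.IsWeakSolution s u₀ u) :
    Tendsto (fun t : ℝ =>
        eLpNorm (fun x => (u t : EuclideanSpace ℝ (Fin n) → ℝ) x - M * FracHeat.heatKernel s t x)
          1 volume) atTop (𝓝 0) ∧
    Tendsto (fun t : ℝ => ENNReal.ofReal (t ^ ((n : ℝ) / (2 * s))) *
        eLpNorm (fun x => (u t : EuclideanSpace ℝ (Fin n) → ℝ) x - M * FracHeat.heatKernel s t x)
          ⊤ volume) atTop (𝓝 0) ∧
    ∀ p : ENNReal, 1 ≤ p →
      Tendsto (fun t : ℝ => ENNReal.ofReal (t ^ ((n : ℝ) / (2 * s) * (1 - (p⁻¹).toReal))) *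
        eLpNorm (fun x => (u t : EuclideanSpace ℝ (Fin n) → ℝ) x - M * FracHeat.heatKernel s t x)
          p volume) atTop (𝓝 0) := by
  have : Nonempty (Fin n) := ⟨⟨0, hn⟩⟩
  have hker : ∀ t : ℝ, 0 < t →
      (fun x => (u t : EuclideanSpace ℝ (Fin n) → ℝ) x - M * FracHeat.heatKernel s t x) =
        fun x => u t x - (∫ y, u₀ y) * stableKernel s t x := fun t ht => by
    ext x
    rw [hM, FracHeat.heatKernel_eq_stableKernel hn hs0 ht]
  have h1 : Tendsto (fun t : ℝ =>
      eLpNorm (fun x => (u t : EuclideanSpace ℝ (Fin n) → ℝ) x - M * FracHeat.heatKernel s t x)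
        1 volume) atTop (𝓝 0) := by
    refine tendsto_of_tendsto_of_tendsto_of_le_of_le' tendsto_const_nhds
      (tendsto_lintegral_enorm_mul_translate hs0 hs1 hu₀) (Eventually.of_forall fun _ => zero_le) ?_
    filter_upwards [eventually_gt_atTop 0] with t ht
    rw [hker t ht]
    exact eLpNorm_one_sub_mul_stableKernel_le hs0 hs1 ht hu₀ (L1.integrable_coeFn _)
      (hu.fourier_eq hs0 hs1 ht.le)
  have htop : Tendsto (fun t : ℝ => ENNReal.ofReal (t ^ ((n : ℝ) / (2 * s))) *
      eLpNorm (fun x => (u t : EuclideanSpace ℝ (Fin n) → ℝ) x - M * FracHeat.heatKernel s t x)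
        ⊤ volume) atTop (𝓝 0) := by
    refine tendsto_of_tendsto_of_tendsto_of_le_of_le' tendsto_const_nhds
      (tendsto_integral_heatMultiplier_mul hs0 hu₀) (Eventually.of_forall fun _ => zero_le) ?_
    filter_upwards [eventually_gt_atTop 0] with t ht
    rw [hker t ht]
    have h := eLpNorm_top_sub_mul_stableKernel_le hs0 hs1 ht hu₀ (L1.integrable_coeFn (u t))
      (hu.fourier_eq hs0 hs1 ht.le)
    rwa [finrank_euclideanSpace_fin] at h
  refine ⟨h1, htop, fun p hp => tendsto_weighted_eLpNorm ?_ h1 htop hp⟩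
  filter_upwards [eventually_gt_atTop 0] with t ht
  rw [hker t ht]
  exact ((L1.integrable_coeFn (u t)).sub
    ((integrable_stableKernel hs0 hs1 ht).const_mul _)).aestronglyMeasurable
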